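/- Let $0<\gamma<1$, $\lambda\ge 0$, $\rho>0$, $\eta\in\mathbb R$, $u\ge 0$ (the value $U(x)$ at a fixed $x$), $\widetilde\lambda=\lambda+(\rho+i\eta)u$, and let $\nu\in\{1,2,3,4\}$. For $G:\mathbb R\to\mathbb C$ and an integer $n\ge 0$ put $$D^{\gamma+n,\widetilde\lambda}G(t)=\Big(\frac{d}{dt}+\widetilde\lambda\Big)^{n+1}I(t),\qquad I(t)=\frac1{\Gamma(1-\gamma)}\int_{-\infty}^t (t-z)^{-\gamma}e^{-\widetilde\lambda (t-z)}G(z)\,dz,$$ $${}^S\!D^{\gamma+n,\widetilde\lambda}G(t)=D^{\gamma+n,\widetilde\lambda}G(t)-\lambda^{\gamma+n}G(t).$$ For $\tau>0$ let $q_m$ $(m\ge 0)$ be the coefficients of the power series at $\zeta=0$ $$\Big(\sum_{l=1}^{\nu}\frac1l\big(1-e^{-\widetilde\lambda\tau}\zeta\big)^l\Big)^{\gamma}=\sum_{m=0}^\infty q_m\zeta^m$$ (principal branch), and let $$A^{\nu,\gamma,\widetilde\lambda}G(t)=\frac1{\tau^\gamma}\sum_{m=0}^\infty q_m\,G(t-m\tau)-\frac1{\tau^\gamma}\Big(\sum_{l=1}^{\nu}\frac1l\big(1-e^{-\lambda\tau}\big)^l\Big)^{\gamma}G(t).$$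 Suppose that $G$ and its Fourier transform belong to $L^1(\mathbb R)$, that ${}^S\!D^{\gamma+\nu,\widetilde\lambda}G$ exists (that is, $I$ is $\nu+1$ times differentiable on $\mathbb R$), and that ${}^S\!D^{\gamma+\nu,\widetilde\lambda}G$ and its Fourier transform belong to $L^1(\mathbb R)$. Then the integral defining $I(t)$ converges absolutely for every $t\in\mathbb R$, and there is a constant $C$, independent of $\tau$ and $t$, such that for every $\tau>0$ and almost every $t\in\mathbb R$ the series in $A^{\nu,\gamma,\widetilde\lambda}G(t)$ converges absolutely and $$\big|{}^S\!D^{\gamma,\widetilde\lambda}G(t)-A^{\nu,\gamma,\widetilde\lambda}G(t)\big|\le C\,\tau^\nu .$$ If moreover $G$ is continuous, then this holds, with the same $C$, for every $\tau>0$ and every $t\in\mathbb R$. -/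

import Mathlib

open scoped FourierTransform

noncomputable section

/-- The complex tempering parameter `lam + p * U(x)` with `p = ρ + i η`; the space variable `x` is
fixed, and `u` is the value `U(x)`. -/
def temperedParam (lam ρ η u : ℝ) : ℂ :=
  (lam : ℂ) + ((ρ : ℂ) + (η : ℂ) * Complex.I) * (u : ℂ)

/-- The integrand `z ↦ (t - z) ^ (-γ) * exp (-σ (t - z)) * G z` of the tempered (substantial)
fractional integral of order `1 - γ`, to be integrated over `z < t`. -/
def substIntegrand (γ : ℝ) (σ : ℂ) (G : ℝ → ℂ) (t z : ℝ) : ℂ :=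
  (((t - z) ^ (-γ) : ℝ) : ℂ) * Complex.exp (-σ * ((t - z : ℝ) : ℂ)) * G z

/-- The substantial fractional integral of order `1 - γ` with lower terminal `-∞`:
`(1 / Γ(1 - γ)) ∫_{-∞}^t (t - z) ^ (-γ) exp (-σ (t - z)) G(z) dz`. -/
def substIntegral (γ : ℝ) (σ : ℂ) (G : ℝ → ℂ) (t : ℝ) : ℂ :=
  ((1 / Real.Gamma (1 - γ) : ℝ) : ℂ) * ∫ z in Set.Iio t, substIntegrand γ σ G t z

/-- The first order operator `d/dt + σ`. -/
def substD (σ : ℂ) (F : ℝ → ℂ) (t : ℝ) : ℂ :=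
  deriv F t + σ * F t

/-- The fractional substantial derivative of order `γ + n` on the whole line (`0 < γ < 1`), with
lower terminal `-∞`: the operator `(d/dt + σ) ^ (n + 1)` applied to the substantial fractional
integral of order `1 - γ`. For `n = 0` it is the derivative of order `γ`. -/
def substFracDeriv (γ : ℝ) (n : ℕ) (σ : ℂ) (G : ℝ → ℂ) : ℝ → ℂ :=
  (substD σ)^[n + 1] (substIntegral γ σ G)

/-- Existence of the fractional substantial derivative of order `γ + n`: each of the `n + 1`
applications of `d/dt + σ` acts on a function that is differentiable on the whole line. -/
def HasSubstFracDeriv (γ : ℝ) (n : ℕ) (σ : ℂ) (G : ℝ → ℂ) : Prop :=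
  ∀ k ≤ n, Differentiable ℝ ((substD σ)^[k] (substIntegral γ σ G))

/-- The (shifted) tempered fractional substantial derivative of order `γ + n`: the fractional
substantial derivative of that order minus `lam ^ (γ + n) * G`. -/
def temperedSubstDeriv (γ : ℝ) (n : ℕ) (lam : ℝ) (σ : ℂ) (G : ℝ → ℂ) (t : ℝ) : ℂ :=
  substFracDeriv γ n σ G t - ((lam ^ (γ + n) : ℝ) : ℂ) * G t

/-- The generating function `ζ ↦ (∑_{l=1}^ν (1 - e^{-σ τ} ζ)^l / l) ^ γ` (principal branch; at
`ζ = 0` the base is the positive number `1 + 1/2 + ⋯ + 1/ν`). -/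
def genFun (ν : ℕ) (γ : ℝ) (σ : ℂ) (τ : ℝ) (ζ : ℂ) : ℂ :=
  (∑ l ∈ Finset.Icc 1 ν, (1 / (l : ℂ)) * (1 - Complex.exp (-σ * (τ : ℂ)) * ζ) ^ l) ^ (γ : ℂ)

/-- The coefficient `q_m` of `ζ ^ m` in the power series of the generating function at `0`. -/
def genCoeff (ν : ℕ) (γ : ℝ) (σ : ℂ) (τ : ℝ) (m : ℕ) : ℂ :=
  iteratedDeriv m (genFun ν γ σ τ) 0 / (m.factorial : ℂ)

/-- The approximation operator with step `τ`:
`τ^{-γ} ∑_{m ≥ 0} q_m G(t - m τ) - τ^{-γ} (∑_{l=1}^ν (1 - e^{-lam τ})^l / l) ^ γ G(t)`. -/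
def approxOp (ν : ℕ) (γ lam : ℝ) (σ : ℂ) (τ : ℝ) (G : ℝ → ℂ) (t : ℝ) : ℂ :=
  ((1 / τ ^ γ : ℝ) : ℂ) * ∑' m : ℕ, genCoeff ν γ σ τ m * G (t - m * τ)
    - ((1 / τ ^ γ : ℝ) : ℂ)
      * (((∑ l ∈ Finset.Icc 1 ν, (1 / (l : ℝ)) * (1 - Real.exp (-lam * τ)) ^ l) ^ γ : ℝ) : ℂ)
      * G t

end

section

open Complex MeasureTheory

/-! Everything becomes a Fourier multiplier in s = `symb σ ω` = σ + 2πiω, which lies in the closed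
right half-plane. The fractional integral multiplies 𝓕 G by s^(γ-1) (`substIntegral_eq_invF`), so
the derivative of order γ multiplies it by s^γ. The series in the approximation multiplies it by
τ^(-γ) P(1 - e^(-sτ))^γ, where P = `logPoly ν` (`hasSum_genCoeff_mul_invF`). Since P(w) is the
Taylor polynomial of -log(1 - w), P(1 - e^(-z)) = z + O(z^(ν+1)), and the two multipliers differ by
at most C |s|^(γ+ν) τ^ν (`exists_norm_cpow_sub_scaled_le`). The subtracted multiples of G are
compared by the same bound at s = λ.

Two points carry the weight. First, P(w) = w Q(w) with Re Q > 0 on |1 - w| ≤ 1 when ν ≤ 4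
(`re_logPolyQuot_pos`), so the principal power splits and its coefficients are absolutely summable.
Second, |s|^(γ+ν) |𝓕 G| must be integrable, although nothing is assumed about the integrability of
intermediate derivatives. `symb_pow_mul_ae_eq` obtains this by replacing each d/dt + σ with a
bounded difference operator, comparing transforms there, and cancelling a factor that is nonzero
almost everywhere. -/

theorem iteratedDeriv_div_factorial_of_hasSum {f : ℂ → ℂ} {a : ℕ → ℂ}
    (h : ∀ ζ : ℂ, ‖ζ‖ < 1 → HasSum (fun m => a m * ζ ^ m) (f ζ)) (m : ℕ) :
    iteratedDeriv m f 0 / (m.factorial : ℂ) = a m := by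
  have hp : HasFPowerSeriesOnBall f (FormalMultilinearSeries.ofScalars ℂ a) 0 1 := by
    refine ⟨?_, by simp, ?_⟩
    · refine ENNReal.le_of_forall_nnreal_lt fun r hr => ?_
      have hr1 : (r : ℝ) < 1 := by exact_mod_cast hr
      refine FormalMultilinearSeries.le_radius_of_tendsto _ (l := 0) ?_
      have := (h (r : ℝ) (by simpa using hr1)).summable.tendsto_atTop_zero.norm
      simpa [FormalMultilinearSeries.ofScalars_norm] using this
    · intro y hy
      have hy1 : ‖y‖ < 1 := by
        rw [← ENNReal.ofReal_one, Metric.eball_ofReal] at hy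
        simpa using hy
      simpa [FormalMultilinearSeries.ofScalars_apply_eq, mul_comm] using h y hy1
  have h1 := hp.factorial_smul (1 : ℂ) m
  rw [iteratedDeriv_eq_iteratedFDeriv, ← h1]
  have : (m.factorial : ℂ) ≠ 0 := by exact_mod_cast m.factorial_ne_zero
  simp
  field_simp

/-- The arguments lie in [-π/2, π/2] and (-π/2, π/2), so their sum stays in (-π, π) and the
logarithms add without a branch correction. -/
theorem Complex.mul_cpow_of_re_nonneg_of_re_pos {x y : ℂ} (hx : 0 ≤ x.re) (hy : 0 < y.re)
    (c : ℂ) : (x * y) ^ c = x ^ c * y ^ c := by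
  have hy0 : y ≠ 0 := fun h => by simp [h] at hy
  rcases eq_or_ne x 0 with rfl | hx0
  · rcases eq_or_ne c 0 with rfl | hc
    · simp
    · simp [hc]
  have h1 := Complex.abs_arg_le_pi_div_two_iff.2 hx
  have h2 := Complex.abs_arg_lt_pi_div_two_iff.2 (Or.inl hy)
  rw [abs_le] at h1
  rw [abs_lt] at h2
  rw [cpow_def_of_ne_zero (mul_ne_zero hx0 hy0), cpow_def_of_ne_zero hx0,
    cpow_def_of_ne_zero hy0, Complex.log_mul hx0 hy0 ⟨by linarith, by linarith⟩, ← Complex.exp_add]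
  ring_nf

/-! ### The generating function on the closed unit disc -/

/-- The truncated logarithmic series `∑_{l=1}^ν w ^ l / l`. -/
noncomputable def logPoly (ν : ℕ) (w : ℂ) : ℂ := ∑ l ∈ Finset.Icc 1 ν, (1 / (l : ℂ)) * w ^ l

/-- The cofactor of `w` in `logPoly ν w`. -/
noncomputable def logPolyQuot (ν : ℕ) (w : ℂ) : ℂ :=
  ∑ l ∈ Finset.range ν, (1 / ((l : ℂ) + 1)) * w ^ l

theorem logPoly_eq_mul (ν : ℕ) (w : ℂ) : logPoly ν w = w * logPolyQuot ν w := by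
  have h : Finset.Icc 1 ν = Finset.Ico (0 + 1) (ν + 1) := by ext l; simp
  rw [logPoly, logPolyQuot, Finset.mul_sum, h, ← Finset.sum_Ico_add', Finset.range_eq_Ico]
  refine Finset.sum_congr rfl fun l _ => ?_
  push_cast
  ring

/-- On the disc (Im w)^2 ≤ 2a - a^2 with a = Re w ≥ 0. Inserting this bound reduces each case to
positivity of a polynomial in a. -/
theorem re_logPolyQuot_pos {ν : ℕ} (h1 : 1 ≤ ν) (h4 : ν ≤ 4) {w : ℂ} (hw : ‖1 - w‖ ≤ 1) :
    0 < (logPolyQuot ν w).re := by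
  have hab : w.im ^ 2 ≤ 2 * w.re - w.re ^ 2 := by
    have := Complex.sq_norm (1 - w)
    rw [Complex.normSq_apply] at this
    simp only [sub_re, one_re, sub_im, one_im] at this
    nlinarith [norm_nonneg (1 - w)]
  have ha : 0 ≤ w.re := by nlinarith [sq_nonneg w.im, sq_nonneg w.re]
  have e2 : (1 / ((1 : ℂ) + 1)) = ((1 / 2 : ℝ) : ℂ) := by norm_num
  have e3 : (1 / ((2 : ℂ) + 1)) = ((1 / 3 : ℝ) : ℂ) := by norm_num
  have e4 : (1 / ((3 : ℂ) + 1)) = ((1 / 4 : ℝ) : ℂ) := by norm_num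
  have p2 : (w ^ 2).re = w.re ^ 2 - w.im ^ 2 := by simp [pow_succ]
  have p3 : (w ^ 3).re = w.re ^ 3 - 3 * w.re * w.im ^ 2 := by simp [pow_succ]; ring
  interval_cases ν
  · simp [logPolyQuot]
  · simp only [logPolyQuot, Finset.sum_range_succ, Finset.range_one, Finset.sum_singleton,
      Nat.cast_zero, Nat.cast_one, pow_zero, pow_one, e2, add_re, re_ofReal_mul]
    norm_num
    linarith
  · simp only [logPolyQuot, Finset.sum_range_succ, Finset.range_one, Finset.sum_singleton,
      Nat.cast_zero, Nat.cast_one, Nat.cast_ofNat, pow_zero, pow_one, e2, e3, add_re,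
      re_ofReal_mul, p2]
    norm_num
    nlinarith [sq_nonneg (w.re - 1 / 8)]
  · simp only [logPolyQuot, Finset.sum_range_succ, Finset.range_one, Finset.sum_singleton,
      Nat.cast_zero, Nat.cast_one, Nat.cast_ofNat, pow_zero, pow_one, e2, e3, e4, add_re,
      re_ofReal_mul, p2, p3]
    norm_num
    -- The lower bound is 1 - a/6 - 5a^2/6 + a^3; the term a(a - 7/10)^2 absorbs the cubic part.
    nlinarith [mul_nonneg ha (sq_nonneg (w.re - 7 / 10)), sq_nonneg (w.re - 1 / 2),
      mul_nonneg ha (sub_nonneg.2 hab)]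

theorem Complex.re_nonneg_of_norm_one_sub_le {w : ℂ} (hw : ‖1 - w‖ ≤ 1) : 0 ≤ w.re := by
  have := (Complex.abs_re_le_norm (1 - w)).trans hw
  simp only [sub_re, one_re, abs_le] at this
  linarith

theorem logPoly_cpow {ν : ℕ} (h1 : 1 ≤ ν) (h4 : ν ≤ 4) {w : ℂ} (hw : ‖1 - w‖ ≤ 1) (c : ℂ) :
    logPoly ν w ^ c = w ^ c * logPolyQuot ν w ^ c := by
  rw [logPoly_eq_mul, Complex.mul_cpow_of_re_nonneg_of_re_pos
    (Complex.re_nonneg_of_norm_one_sub_le hw) (re_logPolyQuot_pos h1 h4 hw)]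

/-- Absolute convergence on the closed unit disc of the power series of an analytic function. -/
theorem exists_summable_hasSum_of_differentiableOn_ball {f : ℂ → ℂ} {R : ℝ} (hR : 1 < R)
    (hf : DifferentiableOn ℂ f (Metric.ball 0 R)) :
    ∃ a : ℕ → ℂ, Summable (fun m => ‖a m‖) ∧
      ∀ ζ : ℂ, ‖ζ‖ ≤ 1 → HasSum (fun m => a m * ζ ^ m) (f ζ) := by
  have h (ζ : ℂ) (hζ : ‖ζ‖ < R) :
      HasSum (fun m => iteratedDeriv m f 0 / m.factorial * ζ ^ m) (f ζ) := by
    have := Complex.hasSum_taylorSeries_on_ball hf (z := ζ) (by simpa using hζ)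
    simp only [sub_zero, smul_eq_mul] at this
    convert! this using 2
    ring
  refine ⟨_, ?_, fun ζ hζ => h ζ (hζ.trans_lt hR)⟩
  -- Convergence at a radius r > 1 bounds the terms there, so the coefficients are O(r^(-m)).
  obtain ⟨r, hr1, hrR⟩ := exists_between hR
  have hr0 : 0 < r := by linarith
  have ht := (h (r : ℂ) (by simpa [abs_of_pos hr0] using hrR)).summable.tendsto_atTop_zero
  obtain ⟨C, hC⟩ := ht.norm.bddAbove_range
  have hg := (summable_geometric_of_lt_one (inv_nonneg.2 hr0.le) (inv_lt_one_of_one_lt₀ hr1)).mul_left C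
  refine Summable.of_nonneg_of_le (fun _ => norm_nonneg _) (fun m => ?_) hg
  have h2 := hC ⟨m, rfl⟩
  simp only [norm_mul, norm_pow, norm_real, Real.norm_eq_abs, abs_of_pos hr0] at h2
  rw [inv_pow, ← div_eq_mul_inv, le_div_iff₀ (by positivity)]
  exact h2

/-- By compactness the positivity of the real part persists on a slightly larger disc, so the
principal power is analytic past the unit circle. -/
theorem exists_hasSum_logPolyQuot_cpow {ν : ℕ} (h1 : 1 ≤ ν) (h4 : ν ≤ 4) (c : ℂ) :
    ∃ a : ℕ → ℂ, Summable (fun m => ‖a m‖) ∧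
      ∀ ζ : ℂ, ‖ζ‖ ≤ 1 → HasSum (fun m => a m * ζ ^ m) (logPolyQuot ν (1 - ζ) ^ c) := by
  have hd : Differentiable ℂ fun ζ : ℂ => logPolyQuot ν (1 - ζ) := by
    unfold logPolyQuot
    fun_prop
  have hopen : IsOpen {ζ : ℂ | 0 < (logPolyQuot ν (1 - ζ)).re} :=
    isOpen_lt continuous_const (continuous_re.comp hd.continuous)
  obtain ⟨δ, hδ, hsub⟩ := (isCompact_closedBall (0 : ℂ) 1).exists_cthickening_subset_open hopen
    (fun ζ hζ => re_logPolyQuot_pos h1 h4 (by simpa using hζ))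
  refine exists_summable_hasSum_of_differentiableOn_ball (R := 1 + δ) (by linarith) fun ζ hζ => ?_
  have : ζ ∈ Metric.cthickening δ (Metric.closedBall (0 : ℂ) 1) := by
    rw [cthickening_closedBall hδ.le zero_le_one]
    rw [Metric.mem_ball] at hζ
    simp only [Metric.mem_closedBall]
    linarith
  exact ((hd ζ).cpow_const (Or.inl (hsub this))).differentiableWithinAt

/-- The coefficients of `(1 - ζ) ^ γ`. -/
theorem exists_hasSum_one_sub_cpow {γ : ℝ} (h0 : 0 < γ) (h1 : γ < 1) :
    ∃ a : ℕ → ℂ, Summable (fun m => ‖a m‖) ∧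
      ∀ ζ : ℂ, ‖ζ‖ ≤ 1 → HasSum (fun m => a m * ζ ^ m) ((1 - ζ) ^ (γ : ℂ)) := by
  set b : ℕ → ℝ := fun m => (-1) ^ m * Ring.choose γ m with hb
  have hser (ζ : ℂ) (hζ : ‖ζ‖ < 1) : HasSum (fun m => (b m : ℂ) * ζ ^ m) ((1 - ζ) ^ (γ : ℂ)) := by
    have := (Complex.one_add_cpow_hasFPowerSeriesOnBall_zero (a := (γ : ℂ))).hasSum (y := -ζ)
      (by rw [← ENNReal.ofReal_one, Metric.eball_ofReal]; simpa using hζ)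
    convert! this using 1
    · ext m
      rw [binomialSeries_apply]
      simp [hb, neg_pow ζ m, Complex.ofReal_choose]
      ring
    · simp [sub_eq_add_neg]
  have hrec (m : ℕ) : b (m + 1) = b m * ((m - γ) / (m + 1)) := by
    have e1 := Ring.descPochhammer_eq_factorial_smul_choose γ m
    have e2 := Ring.descPochhammer_eq_factorial_smul_choose γ (m + 1)
    rw [descPochhammer_succ_right, Polynomial.smeval_mul, e1] at e2
    simp [Polynomial.smeval_natCast, Nat.factorial_succ] at e2
    have hm : (m.factorial : ℝ) ≠ 0 := by exact_mod_cast m.factorial_ne_zero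
    have : (m + 1 : ℝ) ≠ 0 := by positivity
    simp only [hb]
    field_simp
    have e3 : (m.factorial : ℝ) * (Ring.choose γ m * (γ - m)) = m.factorial * ((m + 1) * Ring.choose γ (m + 1)) := by
      linarith
    have e4 := mul_left_cancel₀ hm e3
    rw [pow_succ]
    linear_combination (-1) ^ m * e4
  have hb0 : b 0 = 1 := by simp [hb]
  -- Since 0 < γ < 1, all coefficients after the constant one have the same sign, so absolute
  -- summability reduces to bounded partial sums.
  have hneg (m : ℕ) : b (m + 1) ≤ 0 := by
    induction m with
    | zero => rw [hrec, hb0]; norm_num; exact h0.le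
    | succ m ih =>
      rw [hrec]
      refine mul_nonpos_of_nonpos_of_nonneg ih (div_nonneg ?_ (by positivity))
      push_cast
      linarith [(Nat.cast_nonneg m : (0 : ℝ) ≤ m)]
  -- For 0 < x < 1 the weighted partial sums are at most 1 - (1 - x)^γ ≤ 1; then x tends to 1.
  have hpart (n : ℕ) : ∑ m ∈ Finset.range n, -b (m + 1) ≤ 1 := by
    have hle (x : ℝ) (hx0 : 0 < x) (hx1 : x < 1) :
        ∑ m ∈ Finset.range n, -b (m + 1) * x ^ (m + 1) ≤ 1 := by
      have hs := hser x (by simpa [abs_of_pos hx0] using hx1)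
      have hs' : HasSum (fun m => b m * x ^ m) ((1 - x) ^ γ) := by
        rw [← ofReal_one, ← ofReal_sub, ← ofReal_cpow (by linarith)] at hs
        exact_mod_cast hs
      have hs2 := ((hasSum_nat_add_iff' 1).2 hs').neg
      have := sum_le_hasSum (Finset.range n) (fun m _ => ?_) hs2
      · simp [hb0] at this
        have hp : 0 ≤ (1 - x) ^ γ := Real.rpow_nonneg (by linarith) _
        simp only [neg_mul, Finset.sum_neg_distrib]
        linarith
      · have := hneg m
        have : 0 ≤ x ^ (m + 1) := by positivity
        nlinarith
    have hc : Filter.Tendsto (fun x : ℝ => ∑ m ∈ Finset.range n, -b (m + 1) * x ^ (m + 1))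
        (nhdsWithin 1 (Set.Iio 1)) (nhds (∑ m ∈ Finset.range n, -b (m + 1) * 1 ^ (m + 1))) := by
      refine (Continuous.tendsto ?_ 1).mono_left nhdsWithin_le_nhds
      fun_prop
    simp only [one_pow, mul_one] at hc
    refine le_of_tendsto hc ?_
    filter_upwards [Ioo_mem_nhdsLT (zero_lt_one' ℝ)] with x hx using hle x hx.1 hx.2
  have hsum : Summable fun m => ‖(b m : ℂ)‖ := by
    rw [← summable_nat_add_iff 1]
    simp only [norm_real, Real.norm_eq_abs, abs_of_nonpos (hneg _)]
    exact summable_of_sum_range_le (fun m => neg_nonneg.2 (hneg m)) hpart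
  refine ⟨fun m => (b m : ℂ), hsum, fun ζ hζ => ?_⟩
  have hbound (m : ℕ) (z : ℂ) (hz : ‖z‖ ≤ 1) : ‖(b m : ℂ) * z ^ m‖ ≤ ‖(b m : ℂ)‖ := by
    rw [norm_mul, norm_pow]
    exact mul_le_of_le_one_right (norm_nonneg _) (pow_le_one₀ (norm_nonneg _) hz)
  -- Both sides are continuous on the closed disc, which extends the identity from the open disc to
  -- the boundary.
  have hcont : ContinuousOn (fun z : ℂ => ∑' m, (b m : ℂ) * z ^ m) (Metric.closedBall 0 1) :=
    continuousOn_tsum (fun m => by fun_prop) hsum fun m z hz => hbound m z (by simpa using hz)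
  have hcont2 : ContinuousOn (fun z : ℂ => (1 - z) ^ (γ : ℂ)) (Metric.closedBall 0 1) := by
    intro z hz
    refine ContinuousAt.continuousWithinAt ?_
    refine (Complex.continuousAt_cpow_const_of_re_pos (Or.inl ?_) (by simpa using h0)).comp
      (f := fun z : ℂ => 1 - z) (by fun_prop)
    exact Complex.re_nonneg_of_norm_one_sub_le (by simpa using hz)
  have heq : Set.EqOn (fun z : ℂ => ∑' m, (b m : ℂ) * z ^ m) (fun z : ℂ => (1 - z) ^ (γ : ℂ))
      (Metric.closedBall 0 1) := by
    refine Set.EqOn.of_subset_closure (s := Metric.ball 0 1) (fun z hz => ?_) hcont hcont2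
      Metric.ball_subset_closedBall ?_
    · exact (hser z (by simpa using hz)).tsum_eq
    · rw [closure_ball (0 : ℂ) one_ne_zero]
  have hs : Summable fun m => (b m : ℂ) * ζ ^ m :=
    Summable.of_norm (Summable.of_nonneg_of_le (fun _ => norm_nonneg _)
      (fun m => hbound m ζ hζ) hsum)
  have := heq (x := ζ) (by simpa using hζ)
  simp only at this
  rw [← this]
  exact hs.hasSum

/-- The coefficients are the Cauchy product of those of (1 - ζ)^γ and of the analytic cofactor, both
absolutely summable. -/
theorem exists_hasSum_logPoly_cpow {ν : ℕ} (hν1 : 1 ≤ ν) (hν4 : ν ≤ 4) {γ : ℝ} (h0 : 0 < γ)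
    (h1 : γ < 1) :
    ∃ a : ℕ → ℂ, Summable (fun m => ‖a m‖) ∧
      ∀ ζ : ℂ, ‖ζ‖ ≤ 1 → HasSum (fun m => a m * ζ ^ m) (logPoly ν (1 - ζ) ^ (γ : ℂ)) := by
  obtain ⟨a, ha, ha'⟩ := exists_hasSum_one_sub_cpow h0 h1
  obtain ⟨b, hb, hb'⟩ := exists_hasSum_logPolyQuot_cpow hν1 hν4 (γ : ℂ)
  have hsum := summable_norm_sum_mul_antidiagonal_of_summable_norm ha hb
  refine ⟨_, hsum, fun ζ hζ => ?_⟩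
  have key {a : ℕ → ℂ} (ha : Summable fun m => ‖a m‖) : Summable fun m => ‖a m * ζ ^ m‖ := by
    refine Summable.of_nonneg_of_le (fun _ => norm_nonneg _) (fun m => ?_) ha
    rw [norm_mul, norm_pow]
    exact mul_le_of_le_one_right (norm_nonneg _) (pow_le_one₀ (norm_nonneg _) hζ)
  have h2 := tsum_mul_tsum_eq_tsum_sum_antidiagonal_of_summable_norm (key ha) (key hb)
  rw [(ha' ζ hζ).tsum_eq, (hb' ζ hζ).tsum_eq, ← logPoly_cpow hν1 hν4 (by simpa using hζ)] at h2
  have h3 : (fun n => ∑ kl ∈ Finset.HasAntidiagonal.antidiagonal n, (a kl.1 * ζ ^ kl.1) * (b kl.2 * ζ ^ kl.2))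
      = fun n => (∑ kl ∈ Finset.HasAntidiagonal.antidiagonal n, a kl.1 * b kl.2) * ζ ^ n := by
    ext n
    rw [Finset.sum_mul]
    refine Finset.sum_congr rfl fun kl hkl => ?_
    rw [← Finset.HasAntidiagonal.mem_antidiagonal.1 hkl, pow_add]
    ring
  rw [h3] at h2
  rw [h2]
  exact (Summable.of_norm (key hsum)).hasSum

theorem genCoeff_eq {ν : ℕ} {γ : ℝ} {a : ℕ → ℂ}
    (ha : ∀ ζ : ℂ, ‖ζ‖ ≤ 1 → HasSum (fun m => a m * ζ ^ m) (logPoly ν (1 - ζ) ^ (γ : ℂ)))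
    {σ : ℂ} (hσ : 0 ≤ σ.re) {τ : ℝ} (hτ : 0 < τ) (m : ℕ) :
    genCoeff ν γ σ τ m = a m * exp (-σ * τ) ^ m := by
  refine iteratedDeriv_div_factorial_of_hasSum (a := fun m => a m * exp (-σ * τ) ^ m)
    (fun ζ hζ => ?_) m
  have he : ‖exp (-σ * τ)‖ ≤ 1 := by
    rw [norm_exp, Real.exp_le_one_iff]
    simp
    positivity
  have := ha (exp (-σ * τ) * ζ) (by
    rw [norm_mul]
    exact mul_le_one₀ he (norm_nonneg _) hζ.le)
  simp only [mul_pow, ← mul_assoc] at this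
  exact this

/-! ### Consistency of order ν of the symbol -/

/-- With w = 1 - e^(-z), z = -log(1 - w), so the difference is a Taylor remainder of the logarithm.
The constant collects 2^(ν+1) from |w| ≤ 2|z| and 2 from (1 - |w|)^(-1). -/
theorem norm_logPoly_one_sub_exp_sub_le (ν : ℕ) {z : ℂ} (hz : ‖z‖ ≤ 1 / 4) :
    ‖logPoly ν (1 - exp (-z)) - z‖ ≤ 2 ^ (ν + 2) * ‖z‖ ^ (ν + 1) := by
  set w := 1 - exp (-z) with hw
  have hwz : ‖w‖ ≤ 2 * ‖z‖ := by
    have := Complex.norm_exp_sub_one_le (x := -z) (by rw [norm_neg]; linarith)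
    rwa [norm_neg, ← norm_neg, neg_sub] at this
  have hT : logTaylor (ν + 1) (-w) = -logPoly ν w := by
    rw [logTaylor, logPoly, Finset.range_eq_Ico, Finset.sum_eq_sum_Ico_succ_bot (by omega)]
    have h : Finset.Icc 1 ν = Finset.Ico (0 + 1) (ν + 1) := by ext l; simp
    rw [h, ← Finset.sum_neg_distrib]
    simp only [Nat.cast_zero, div_zero, zero_add]
    refine Finset.sum_congr rfl fun l _ => ?_
    rw [neg_pow w, pow_succ]
    have : ((-1 : ℂ) ^ l) * (-1) ^ l = 1 := by rw [← mul_pow]; simp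
    linear_combination (-(w ^ l) / l) * this
  have hlog : log (1 + -w) = -z := by
    have him := (abs_le.1 ((Complex.abs_im_le_norm z).trans hz))
    have := Real.pi_gt_three
    rw [hw, show (1 : ℂ) + -(1 - exp (-z)) = exp (-z) by ring, log_exp] <;> simp <;> linarith
  have h1 := norm_log_sub_logTaylor_le ν (z := -w) (by rw [norm_neg]; linarith)
  rw [hT, hlog, norm_neg, show -z - -logPoly ν w = logPoly ν w - z by ring] at h1
  refine h1.trans ?_
  have h2 : (1 - ‖w‖)⁻¹ ≤ 2 := by
    rw [inv_le_comm₀ (by linarith) (by norm_num)]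
    linarith
  have h3 : ‖w‖ ^ (ν + 1) ≤ (2 * ‖z‖) ^ (ν + 1) := by gcongr
  have h4 : 0 ≤ (1 - ‖w‖)⁻¹ := inv_nonneg.2 (by linarith)
  calc ‖w‖ ^ (ν + 1) * (1 - ‖w‖)⁻¹ / (ν + 1) ≤ ‖w‖ ^ (ν + 1) * (1 - ‖w‖)⁻¹ :=
        div_le_self (by positivity) (by linarith [(Nat.cast_nonneg ν : (0 : ℝ) ≤ ν)])
    _ ≤ (2 * ‖z‖) ^ (ν + 1) * 2 := by gcongr
    _ = _ := by rw [mul_pow]; ring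

theorem norm_cpow_sub_one_le {γ : ℝ} (h0 : 0 < γ) (h1 : γ ≤ 1) {r : ℂ} (hr : ‖r - 1‖ ≤ 1 / 2) :
    ‖r ^ (γ : ℂ) - 1‖ ≤ 3 * ‖r - 1‖ := by
  have hr0 : r ≠ 0 := by
    rintro rfl
    norm_num at hr
  have hlog := norm_log_one_add_half_le_self hr
  rw [add_sub_cancel] at hlog
  have hle : ‖log r * γ‖ ≤ 3 / 2 * ‖r - 1‖ := by
    rw [norm_mul, norm_real, Real.norm_eq_abs, abs_of_pos h0]
    exact (mul_le_of_le_one_right (norm_nonneg _) h1).trans hlog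
  rw [cpow_def_of_ne_zero hr0]
  have := Complex.norm_exp_sub_one_le (x := log r * γ) (by linarith)
  linarith

theorem norm_logPoly_le (ν : ℕ) {w : ℂ} (hw : ‖w‖ ≤ 2) :
    ‖logPoly ν w‖ ≤ ∑ l ∈ Finset.Icc 1 ν, 1 / (l : ℝ) * 2 ^ l := by
  refine norm_sum_le_of_le _ fun l _ => ?_
  rw [norm_mul, norm_pow, norm_div, norm_one, Complex.norm_natCast]
  gcongr

/-- Symbol estimate: the generating function agrees with `z ^ γ` to order `γ + ν` on the closed
right half-plane. -/
theorem exists_norm_logPoly_cpow_sub_cpow_le {ν : ℕ} (hν : 1 ≤ ν) {γ : ℝ} (h0 : 0 < γ)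
    (h1 : γ ≤ 1) :
    ∃ C : ℝ, 0 ≤ C ∧ ∀ z : ℂ, 0 ≤ z.re →
      ‖logPoly ν (1 - exp (-z)) ^ (γ : ℂ) - z ^ (γ : ℂ)‖ ≤ C * ‖z‖ ^ (γ + ν) := by
  set K : ℝ := ∑ l ∈ Finset.Icc 1 ν, 1 / (l : ℝ) * 2 ^ l with hK
  have hK0 : 0 ≤ K := Finset.sum_nonneg fun l _ => by positivity
  -- Chosen so that 2^(ν+2) δ = 1/2, which keeps P/z within 1/2 of 1 when |z| ≤ δ; then P^γ = z^γ
  -- (P/z)^γ.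
  set δ : ℝ := 1 / 2 ^ (ν + 3) with hδ
  have hδ0 : 0 < δ := by positivity
  have hδ4 : δ ≤ 1 / 4 := by
    rw [hδ]
    refine one_div_le_one_div_of_le (by norm_num) ?_
    calc (4 : ℝ) = 2 ^ 2 := by norm_num
      _ ≤ 2 ^ (ν + 3) := pow_le_pow_right₀ (by norm_num) (by omega)
  have hfar : 0 ≤ K ^ γ / δ ^ (γ + ν) + 1 / δ ^ (ν : ℝ) := by positivity
  refine ⟨max (3 * 2 ^ (ν + 2)) (K ^ γ / δ ^ (γ + ν) + 1 / δ ^ (ν : ℝ)),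
    le_max_of_le_right hfar, fun z hz => ?_⟩
  have hpow : 0 ≤ ‖z‖ ^ (γ + ν) := by positivity
  rcases le_total ‖z‖ δ with hzδ | hzδ
  · refine le_trans ?_ (mul_le_mul_of_nonneg_right (le_max_left _ _) hpow)
    rcases eq_or_ne z 0 with rfl | hz0
    · have : (γ : ℂ) ≠ 0 := by exact_mod_cast h0.ne'
      have h2 : logPoly ν 0 = 0 := by simp [logPoly_eq_mul]
      simp [this, h2]
      positivity
    have hzpos : 0 < ‖z‖ := norm_pos_iff.2 hz0
    set P := logPoly ν (1 - exp (-z))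
    have hP : ‖P - z‖ ≤ 2 ^ (ν + 2) * ‖z‖ ^ (ν + 1) :=
      norm_logPoly_one_sub_exp_sub_le ν (hzδ.trans hδ4)
    have hr : ‖P / z - 1‖ ≤ 2 ^ (ν + 2) * ‖z‖ ^ ν := by
      rw [div_sub_one hz0, norm_div, div_le_iff₀ hzpos, mul_assoc, ← pow_succ]
      exact hP
    have hr2 : ‖P / z - 1‖ ≤ 1 / 2 := by
      refine hr.trans ?_
      calc (2 : ℝ) ^ (ν + 2) * ‖z‖ ^ ν ≤ 2 ^ (ν + 2) * ‖z‖ := by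
            gcongr
            exact pow_le_of_le_one hzpos.le (by linarith) (by omega)
        _ ≤ 2 ^ (ν + 2) * δ := by gcongr
        _ = 1 / 2 := by rw [hδ]; field_simp; ring
    have hre : 0 < (P / z).re := by
      have := (abs_le.1 ((Complex.abs_re_le_norm _).trans hr2)).1
      simp only [sub_re, one_re] at this
      linarith
    have hPe : P ^ (γ : ℂ) = z ^ (γ : ℂ) * (P / z) ^ (γ : ℂ) := by
      rw [← Complex.mul_cpow_of_re_nonneg_of_re_pos hz hre, mul_div_cancel₀ _ hz0]
    rw [hPe, ← mul_sub_one, norm_mul, Complex.norm_cpow_real, Real.rpow_add hzpos,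
      Real.rpow_natCast]
    have := norm_cpow_sub_one_le h0 h1 hr2
    calc ‖z‖ ^ γ * ‖(P / z) ^ (γ : ℂ) - 1‖ ≤ ‖z‖ ^ γ * (3 * (2 ^ (ν + 2) * ‖z‖ ^ ν)) := by
          gcongr
          linarith
      _ = _ := by ring
  -- Away from 0 no cancellation is needed: P is bounded by K, and powers of |z|/δ ≥ 1 supply the
  -- growth.
  · refine le_trans ?_ (mul_le_mul_of_nonneg_right (le_max_right _ _) hpow)
    have hzpos : 0 < ‖z‖ := hδ0.trans_le hzδ
    have hw : ‖1 - exp (-z)‖ ≤ 2 := by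
      refine (norm_sub_le _ _).trans ?_
      have : ‖exp (-z)‖ ≤ 1 := by
        rw [norm_exp, Real.exp_le_one_iff]
        simpa using hz
      rw [norm_one]
      linarith
    refine (norm_sub_le _ _).trans ?_
    rw [Complex.norm_cpow_real, Complex.norm_cpow_real, add_mul]
    have hge : 1 ≤ ‖z‖ ^ (γ + ν) / δ ^ (γ + ν) := by
      rw [one_le_div (by positivity)]
      gcongr
    have hge2 : 1 ≤ ‖z‖ ^ (ν : ℝ) / δ ^ (ν : ℝ) := by
      rw [one_le_div (by positivity)]
      gcongr
    have hle : ‖logPoly ν (1 - exp (-z))‖ ^ γ ≤ K ^ γ := by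
      gcongr
      exact norm_logPoly_le ν hw
    refine add_le_add ?_ ?_
    · calc _ ≤ K ^ γ := hle
        _ ≤ K ^ γ * (‖z‖ ^ (γ + ν) / δ ^ (γ + ν)) := le_mul_of_one_le_right (by positivity) hge
        _ = _ := by ring
    · rw [Real.rpow_add hzpos]
      calc _ ≤ ‖z‖ ^ γ * (‖z‖ ^ (ν : ℝ) / δ ^ (ν : ℝ)) :=
            le_mul_of_one_le_right (by positivity) hge2
        _ = _ := by ring

/-! ### Laplace transform of the kernel -/

theorem integrableOn_rpow_mul_exp_neg_mul {a b : ℝ} (ha : -1 < a) (hb : 0 < b) :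
    MeasureTheory.IntegrableOn (fun x : ℝ => x ^ a * Real.exp (-b * x)) (Set.Ioi 0) := by
  simpa using integrableOn_rpow_mul_exp_neg_mul_rpow ha zero_lt_one hb

/-- The Laplace transform of `x ↦ x ^ (-γ)` on the right half-plane. -/
theorem integral_rpow_neg_mul_cexp {γ : ℝ} (h1 : γ < 1) {s : ℂ} (hs : 0 < s.re) :
    ∫ x : ℝ in Set.Ioi 0, ((x ^ (-γ) : ℝ) : ℂ) * exp (-s * x)
      = Real.Gamma (1 - γ) * s ^ ((γ : ℂ) - 1) := by
  set U : Set ℂ := {s | 0 < s.re} with hU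
  have hUo : IsOpen U := isOpen_lt continuous_const continuous_re
  have hUc : IsPreconnected U := (convex_halfSpace_re_gt 0).isPreconnected
  have hmeas (a : ℝ) : Measurable fun x : ℝ => ((x ^ a : ℝ) : ℂ) := by fun_prop
  have hd : DifferentiableOn ℂ
      (fun s : ℂ => ∫ x : ℝ in Set.Ioi 0, ((x ^ (-γ) : ℝ) : ℂ) * exp (-s * x)) U := by
    intro s hs
    have hs' : 0 < s.re / 2 := half_pos hs
    refine (hasDerivAt_integral_of_dominated_loc_of_deriv_le
      (F' := fun s x => -(x : ℂ) * (((x ^ (-γ) : ℝ) : ℂ) * exp (-s * x)))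
      (bound := fun x => x ^ (1 - γ) * Real.exp (-(s.re / 2) * x))
      (Metric.ball_mem_nhds s hs') ?_ ?_ ?_ ?_ ?_ ?_).2.differentiableAt.differentiableWithinAt
    · exact Filter.Eventually.of_forall fun z => (by fun_prop : Measurable _).aestronglyMeasurable
    · refine (integrableOn_rpow_mul_exp_neg_mul (a := -γ) (by linarith) hs).mono'
        (by fun_prop : Measurable _).aestronglyMeasurable ?_
      filter_upwards [MeasureTheory.ae_restrict_mem measurableSet_Ioi] with x hx
      rw [norm_mul, norm_real, norm_exp, Real.norm_of_nonneg (Real.rpow_nonneg (le_of_lt hx) _)]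
      simp
    · exact (by fun_prop : Measurable _).aestronglyMeasurable
    · filter_upwards [MeasureTheory.ae_restrict_mem measurableSet_Ioi] with x hx z hz
      have hx0 : (0 : ℝ) < x := hx
      have hzre : s.re / 2 ≤ z.re := by
        rw [Metric.mem_ball, dist_eq_norm] at hz
        have := (abs_le.1 ((Complex.abs_re_le_norm (z - s)).trans hz.le)).1
        simp only [sub_re] at this
        linarith
      rw [norm_mul, norm_mul, norm_neg, norm_real, norm_real, norm_exp,
        Real.norm_of_nonneg (Real.rpow_nonneg hx0.le _), Real.norm_of_nonneg hx0.le, ← mul_assoc,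
        show 1 - γ = 1 + -γ by ring, Real.rpow_add hx0, Real.rpow_one]
      simp only [mul_re, neg_re, ofReal_re, neg_im, ofReal_im, mul_zero, sub_zero]
      gcongr
    · exact integrableOn_rpow_mul_exp_neg_mul (by linarith) hs'
    · filter_upwards with x z hz
      have h := (((hasDerivAt_id z).neg.mul_const (x : ℂ)).cexp).const_mul ((x ^ (-γ) : ℝ) : ℂ)
      convert! h using 1
      simp
      ring
  have hd2 : DifferentiableOn ℂ
      (fun s : ℂ => (Real.Gamma (1 - γ) : ℂ) * s ^ ((γ : ℂ) - 1)) U := fun s hs =>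
    ((differentiableAt_id.cpow_const (Or.inl hs)).const_mul _).differentiableWithinAt
  -- Identity theorem: both sides are holomorphic on the half-plane and agree at real points x > 1
  -- accumulating at 1, by the real Gamma integral.
  refine AnalyticOnNhd.eqOn_of_preconnected_of_frequently_eq (hd.analyticOnNhd hUo)
    (hd2.analyticOnNhd hUo) hUc (z₀ := 1) (by simp [hU]) ?_ hs
  have ht : Filter.Tendsto (fun x : ℝ => (x : ℂ)) (nhdsWithin 1 (Set.Ioi 1))
      (nhdsWithin 1 {1}ᶜ) := by
    refine tendsto_nhdsWithin_iff.2 ⟨?_, ?_⟩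
    · exact (Complex.continuous_ofReal.tendsto' 1 1 (by simp)).mono_left nhdsWithin_le_nhds
    · filter_upwards [self_mem_nhdsWithin] with x hx
      have : x ≠ 1 := (Set.mem_Ioi.1 hx).ne'
      simpa using this
  refine ht.frequently (Filter.Eventually.frequently ?_)
  filter_upwards [self_mem_nhdsWithin] with x hx
  have hx0 : 0 < x := zero_lt_one.trans hx
  have h := Real.integral_rpow_mul_exp_neg_mul_Ioi (a := 1 - γ) (by linarith) hx0
  rw [show (γ : ℂ) - 1 = ((γ - 1 : ℝ) : ℂ) by push_cast; rfl, ← ofReal_cpow hx0.le, ← ofReal_mul,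
    mul_comm (Real.Gamma _)]
  rw [one_div, Real.inv_rpow hx0.le, ← Real.rpow_neg hx0.le] at h
  rw [show γ - 1 = -(1 - γ) by ring, ← h, ← integral_complex_ofReal]
  congr 1
  ext t
  push_cast
  rw [show (1 : ℝ) - γ - 1 = -γ by ring, neg_mul]

/-! ### Fourier inversion for integrable functions -/

/-- The inverse Fourier integral of `H`, with an explicit kernel. -/
noncomputable def invF (H : ℝ → ℂ) (t : ℝ) : ℂ := ∫ ω : ℝ, exp ((2 * Real.pi * ω * t : ℝ) * I) * H ω

theorem invF_eq_fourierInv (H : ℝ → ℂ) : invF H = 𝓕⁻ H := by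
  ext t
  rw [Real.fourierInv_eq', invF]
  refine integral_congr_ae (Filter.Eventually.of_forall fun ω => ?_)
  simp only [smul_eq_mul, RCLike.inner_apply, conj_trivial]
  rw [show 2 * Real.pi * (t * ω) = 2 * Real.pi * ω * t by ring]

theorem invF_eq_fourier_neg (H : ℝ → ℂ) (t : ℝ) : invF H t = 𝓕 H (-t) := by
  rw [invF_eq_fourierInv, Real.fourierInv_eq_fourier_neg]

theorem norm_invF_le (H : ℝ → ℂ) (t : ℝ) : ‖invF H t‖ ≤ ∫ ω, ‖H ω‖ := by
  refine (norm_integral_le_integral_norm _).trans_eq ?_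
  simp only [norm_mul, norm_exp_ofReal_mul_I, one_mul]

theorem continuous_fourier_of_integrable {f : ℝ → ℂ} (hf : Integrable f) : Continuous (𝓕 f) :=
  VectorFourier.fourierIntegral_continuous Real.continuous_fourierChar (by fun_prop) hf

theorem continuous_invF {H : ℝ → ℂ} (hH : Integrable H) : Continuous (invF H) := by
  have : invF H = fun t => 𝓕 H (-t) := funext (invF_eq_fourier_neg H)
  rw [this]
  exact (continuous_fourier_of_integrable hH).comp continuous_neg

theorem integrable_exp_mul {H : ℝ → ℂ} (hH : Integrable H) (t : ℝ) :
    Integrable fun ω : ℝ => exp ((2 * Real.pi * ω * t : ℝ) * I) * H ω := by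
  refine hH.bdd_mul (c := 1) (by fun_prop : Continuous _).aestronglyMeasurable ?_
  exact Filter.Eventually.of_forall fun ω => (norm_exp_ofReal_mul_I _).le

theorem integral_fourier_mul_eq {f g : ℝ → ℂ} (hf : Integrable f) (hg : Integrable g) :
    ∫ x, 𝓕 f x * g x = ∫ x, f x * 𝓕 g x := by
  simpa using! (VectorFourier.integral_fourierIntegral_smul_eq_flip (L := innerₗ ℝ)
    Real.continuous_fourierChar (by fun_prop) hf hg)

/-- Fourier inversion almost everywhere, without a continuity hypothesis. -/
theorem ae_eq_invF_fourier {f : ℝ → ℂ} (hf : Integrable f) (hf' : Integrable (𝓕 f)) :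
    f =ᵐ[volume] invF (𝓕 f) := by
  have hc := continuous_invF hf'
  have hloc : LocallyIntegrable (fun x => f x - invF (𝓕 f) x) :=
    hf.locallyIntegrable.sub hc.locallyIntegrable
  -- Tested against a smooth compactly supported g, both functions give the integral of 𝓕 f against
  -- the Schwartz function 𝓕⁻ g.
  have := ae_eq_zero_of_integral_contDiff_smul_eq_zero hloc fun g hg hgs => ?_
  · filter_upwards [this] with x hx using sub_eq_zero.1 hx
  have hgs' : HasCompactSupport (fun x => (g x : ℂ)) := hgs.comp_left (g := fun x : ℝ => (x : ℂ)) rfl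
  have hg' : ContDiff ℝ (⊤ : ℕ∞) (fun x => (g x : ℂ)) := ofRealCLM.contDiff.comp hg
  set φ : SchwartzMap ℝ ℂ := hgs'.toSchwartzMap hg' with hφ
  have hφg (x : ℝ) : φ x = (g x : ℂ) := rfl
  set ψ : SchwartzMap ℝ ℂ := 𝓕⁻ φ with hψ
  have hψφ : 𝓕 (ψ : ℝ → ℂ) = φ := by
    rw [← SchwartzMap.fourier_coe, hψ, FourierTransform.fourier_fourierInv_eq]
  have e1 : ∫ x, φ x * f x = ∫ x, ψ x * 𝓕 f x := by
    rw [← integral_fourier_mul_eq ψ.integrable hf, hψφ]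
  have e2 : ∫ x, φ x * invF (𝓕 f) x = ∫ x, ψ x * 𝓕 f x := by
    have hneg : 𝓕 (fun x => φ (-x)) = ψ := by
      rw [hψ, SchwartzMap.fourierInv_coe, Real.fourierInv_eq_fourier_comp_neg]
    rw [← hneg, integral_fourier_mul_eq φ.integrable.comp_neg hf',
      ← integral_neg_eq_self (fun x => φ (-x) * _)]
    simp [invF_eq_fourier_neg]
  have i1 : Integrable fun x => φ x * f x :=
    hf.bdd_mul (c := ‖φ.toBoundedContinuousFunction‖) φ.continuous.aestronglyMeasurable
      (Filter.Eventually.of_forall fun x => φ.toBoundedContinuousFunction.norm_coe_le_norm x)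
  have i2 : Integrable fun x => φ x * invF (𝓕 f) x :=
    φ.integrable.mul_bdd (c := ∫ ω, ‖𝓕 f ω‖) hc.aestronglyMeasurable
      (Filter.Eventually.of_forall fun x => norm_invF_le _ _)
  have : ∀ x, g x • (f x - invF (𝓕 f) x) = φ x * f x - φ x * invF (𝓕 f) x := fun x => by
    rw [hφg, real_smul]; ring
  simp_rw [this]
  rw [integral_sub i1 i2, e1, e2, sub_self]

/-- The difference has zero transform, which is integrable, so inversion applies to it. -/
theorem ae_eq_of_invF_eq {V₁ V₂ : ℝ → ℂ} (h₁ : Integrable V₁) (h₂ : Integrable V₂)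
    (h : ∀ t, invF V₁ t = invF V₂ t) : V₁ =ᵐ[volume] V₂ := by
  have h0 : 𝓕 (V₁ - V₂) = 0 := by
    ext t
    have e := invF_eq_fourier_neg (V₁ - V₂) (-t)
    rw [neg_neg] at e
    rw [← e, invF]
    simp only [Pi.sub_apply, mul_sub, Pi.zero_apply]
    rw [integral_sub (integrable_exp_mul h₁ _) (integrable_exp_mul h₂ _)]
    exact sub_eq_zero.2 (h (-t))
  have := ae_eq_invF_fourier (h₁.sub h₂) (by rw [h0]; exact integrable_zero _ _ _)
  rw [h0] at this
  filter_upwards [this] with x hx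
  simpa [invF, sub_eq_zero] using hx

/-- Convolution of an integrable kernel with an inverse Fourier integral. -/
theorem integral_mul_invF_sub {k V : ℝ → ℂ} {μ : Measure ℝ} [SFinite μ] (hk : Integrable k μ)
    (hV : Integrable V) (t : ℝ) :
    ∫ y, k y * invF V (t - y) ∂μ
      = invF (fun ω => (∫ y, k y * exp (-((2 * Real.pi * ω : ℝ) * I) * y) ∂μ) * V ω) t := by
  have hint : Integrable (Function.uncurry fun (y ω : ℝ) =>
      k y * (exp ((2 * Real.pi * ω * (t - y) : ℝ) * I) * V ω)) (μ.prod volume) := by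
    have h := (hk.mul_prod hV).bdd_mul (c := 1)
      (f := fun z : ℝ × ℝ => exp ((2 * Real.pi * z.2 * (t - z.1) : ℝ) * I))
      (by fun_prop : Continuous _).aestronglyMeasurable
      (Filter.Eventually.of_forall fun ω => (norm_exp_ofReal_mul_I _).le)
    refine h.congr (Filter.Eventually.of_forall fun z => ?_)
    simp only [Function.uncurry]
    ring
  calc ∫ y, k y * invF V (t - y) ∂μ
      = ∫ y, (∫ ω, k y * (exp ((2 * Real.pi * ω * (t - y) : ℝ) * I) * V ω)) ∂μ := by
        simp_rw [invF, integral_const_mul]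
    _ = ∫ ω, (∫ y, k y * (exp ((2 * Real.pi * ω * (t - y) : ℝ) * I) * V ω) ∂μ) :=
        integral_integral_swap hint
    _ = _ := by
        rw [invF]
        congr 1
        ext ω
        rw [← integral_mul_const, ← integral_const_mul]
        congr 1
        ext y
        have : exp ((2 * Real.pi * ω * (t - y) : ℝ) * I)
            = exp ((2 * Real.pi * ω * t : ℝ) * I) * exp (-((2 * Real.pi * ω : ℝ) * I) * y) := by
          rw [← Complex.exp_add]
          congr 1
          push_cast
          ring
        rw [this]
        ring

/-! ### From pointwise derivatives to multipliers -/

/-- The symbol of `d/dt + σ`. -/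
noncomputable def symb (σ : ℂ) (ω : ℝ) : ℂ := σ + (2 * Real.pi * ω : ℝ) * I

theorem continuous_symb (σ : ℂ) : Continuous (symb σ) := by
  unfold symb
  fun_prop

theorem symb_re (σ : ℂ) (ω : ℝ) : (symb σ ω).re = σ.re := by simp [symb]

theorem symb_im (σ : ℂ) (ω : ℝ) : (symb σ ω).im = σ.im + 2 * Real.pi * ω := by simp [symb]

theorem hasDerivAt_invF {M : ℝ → ℂ} (hM : Integrable M) (hM' : Integrable fun ω : ℝ => (ω : ℂ) * M ω)
    (t : ℝ) : HasDerivAt (invF M) (invF (fun ω => (2 * Real.pi * ω : ℝ) * I * M ω) t) t := by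
  have h := (Real.hasDerivAt_fourier hM (by simpa using hM') (-t)).scomp t (hasDerivAt_neg t)
  have e : invF M = 𝓕 M ∘ Neg.neg := funext (invF_eq_fourier_neg M)
  rw [e]
  convert! h using 1
  rw [invF_eq_fourier_neg, neg_one_smul, Real.fourier_real_eq, Real.fourier_real_eq, ← integral_neg]
  congr 1
  ext ω
  rw [← smul_neg]
  congr 1
  simp only [smul_eq_mul]
  push_cast
  ring

theorem substD_invF {σ : ℂ} {M : ℝ → ℂ} (hM : Integrable M)
    (hM' : Integrable fun ω => symb σ ω * M ω) (t : ℝ) :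
    substD σ (invF M) t = invF (fun ω => symb σ ω * M ω) t := by
  have hω : Integrable fun ω => (2 * Real.pi * ω : ℝ) * I * M ω := by
    refine (hM'.sub (hM.const_mul σ)).congr (Filter.Eventually.of_forall fun ω => ?_)
    simp only [Pi.sub_apply, symb]
    ring
  have hω' : Integrable fun ω : ℝ => (ω : ℂ) * M ω := by
    refine (hω.const_mul ((2 * Real.pi : ℝ) * I)⁻¹).congr (Filter.Eventually.of_forall fun ω => ?_)
    have : (Real.pi : ℂ) ≠ 0 := by exact_mod_cast Real.pi_ne_zero
    simp
    field_simp
    rw [I_sq]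
    ring
  rw [substD, (hasDerivAt_invF hM hω' t).deriv, invF, invF, invF, ← integral_const_mul]
  refine (integral_add (integrable_exp_mul hω t) ((integrable_exp_mul hM t).const_mul σ)).symm.trans
    ?_
  congr 1
  ext ω
  simp only [symb]
  ring

/-- The tempered backward difference of unit step. -/
noncomputable def temperedDiff (σ : ℂ) (Y : ℝ → ℂ) (t : ℝ) : ℂ := Y t - exp (-σ) * Y (t - 1)

/-- The symbol of the convolution operator that turns `d/dt + σ` into `temperedDiff σ`. -/
noncomputable def diffSymb (σ : ℂ) (ω : ℝ) : ℂ :=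
  ∫ y in Set.Ioc (0 : ℝ) 1, exp (-σ * y) * exp (-((2 * Real.pi * ω : ℝ) * I) * y)

theorem symb_mul_diffSymb (σ : ℂ) (ω : ℝ) : symb σ ω * diffSymb σ ω = 1 - exp (-symb σ ω) := by
  have h : diffSymb σ ω = ∫ y in (0 : ℝ)..1, exp (-symb σ ω * y) := by
    rw [intervalIntegral.integral_of_le zero_le_one, diffSymb]
    congr 1
    ext y
    rw [← Complex.exp_add, symb]
    ring_nf
  rw [h]
  rcases eq_or_ne (symb σ ω) 0 with h0 | h0
  · simp [h0]
  · rw [integral_exp_mul_complex (neg_ne_zero.2 h0)]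
    simp
    field_simp
    ring

theorem norm_exp_neg_mul_le {σ : ℂ} (hσ : 0 ≤ σ.re) {y : ℝ} (hy : 0 ≤ y) :
    ‖exp (-σ * y)‖ ≤ 1 := by
  rw [norm_exp, Real.exp_le_one_iff]
  simp
  positivity

theorem norm_diffSymb_le {σ : ℂ} (hσ : 0 ≤ σ.re) (ω : ℝ) : ‖diffSymb σ ω‖ ≤ 1 := by
  have := norm_setIntegral_le_of_norm_le_const (μ := volume) (s := Set.Ioc (0 : ℝ) 1) (C := 1)
    (f := fun y : ℝ => exp (-σ * y) * exp (-((2 * Real.pi * ω : ℝ) * I) * y)) (by simp)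
    (fun y hy => by
      rw [norm_mul]
      refine mul_le_one₀ (norm_exp_neg_mul_le hσ hy.1.le) (norm_nonneg _)
        (norm_exp_neg_mul_le (by simp) hy.1.le))
  simpa [diffSymb] using this

theorem measurable_diffSymb (σ : ℂ) : Measurable (diffSymb σ) := by
  unfold diffSymb
  refine StronglyMeasurable.measurable ?_
  refine StronglyMeasurable.integral_prod_right (f := fun (ω y : ℝ) =>
    exp (-σ * y) * exp (-((2 * Real.pi * ω : ℝ) * I) * y)) ?_
  exact (by fun_prop : Continuous _).stronglyMeasurable

theorem integrable_diffSymb_mul {σ : ℂ} (hσ : 0 ≤ σ.re) {V : ℝ → ℂ} (hV : Integrable V) :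
    Integrable fun ω => diffSymb σ ω * V ω :=
  hV.bdd_mul (measurable_diffSymb σ).aestronglyMeasurable
    (Filter.Eventually.of_forall (norm_diffSymb_le hσ))

/-- The function e^(-σy) (`substD σ Y`)(t - y) is the y-derivative of -e^(-σy) Y(t - y), so
integrating over [0, 1] gives the difference. Integrability of Y on the line is not needed. -/
theorem temperedDiff_eq_invF {σ : ℂ} {Y V : ℝ → ℂ} (hY : Differentiable ℝ Y)
    (hV : Integrable V) (h : substD σ Y =ᵐ[volume] invF V) (t : ℝ) :
    temperedDiff σ Y t = invF (fun ω => diffSymb σ ω * V ω) t := by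
  have hcont : Continuous fun y : ℝ => exp (-σ * y) * invF V (t - y) :=
    (by fun_prop : Continuous fun y : ℝ => exp (-σ * y)).mul
      ((continuous_invF hV).comp (continuous_const.sub continuous_id))
  have hae : (fun y : ℝ => exp (-σ * y) * invF V (t - y)) =ᵐ[volume]
      fun y : ℝ => exp (-σ * y) * substD σ Y (t - y) := by
    have := (quasiMeasurePreserving_sub_left volume t).ae_eq h
    filter_upwards [this] with y hy
    simp only [Function.comp] at hy
    rw [hy]
  have hd (y : ℝ) : HasDerivAt (fun y : ℝ => -(exp (-σ * y) * Y (t - y)))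
      (exp (-σ * y) * substD σ Y (t - y)) y := by
    have h1 : HasDerivAt (fun y : ℝ => exp (-σ * y)) (exp (-σ * y) * (-σ * 1)) y :=
      ((hasDerivAt_id y).ofReal_comp.const_mul (-σ)).cexp
    have h2 : HasDerivAt (fun y : ℝ => Y (t - y)) (-deriv Y (t - y)) y := by
      simpa using! (hY (t - y)).hasDerivAt.scomp y ((hasDerivAt_id y).const_sub t)
    convert! (h1.mul h2).neg using 1
    rw [substD]
    ring
  -- The derivative need not be continuous; its interval integrability comes from the continuous
  -- representative `invF V`.
  have hftc := intervalIntegral.integral_eq_sub_of_hasDerivAt (a := 0) (b := 1)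
    (fun y _ => hd y)
    ((hcont.intervalIntegrable (μ := volume) 0 1).congr_ae (ae_restrict_of_ae hae))
  rw [intervalIntegral.integral_of_le zero_le_one,
    ← integral_congr_ae (ae_restrict_of_ae hae),
    integral_mul_invF_sub ((by fun_prop : Continuous fun y : ℝ => exp (-σ * y)).integrableOn_Ioc)
      hV t] at hftc
  rw [temperedDiff]
  unfold diffSymb
  rw [hftc]
  simp
  ring

theorem differentiable_temperedDiff {σ : ℂ} {Y : ℝ → ℂ} (hY : Differentiable ℝ Y) :
    Differentiable ℝ (temperedDiff σ Y) := by
  unfold temperedDiff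
  fun_prop

theorem substD_temperedDiff {σ : ℂ} {Y : ℝ → ℂ} (hY : Differentiable ℝ Y) :
    substD σ (temperedDiff σ Y) = temperedDiff σ (substD σ Y) := by
  ext t
  have h2 : HasDerivAt (fun t : ℝ => Y (t - 1)) (deriv Y (t - 1)) t := by
    simpa using (hY (t - 1)).hasDerivAt.comp_sub_const t 1
  have h : HasDerivAt (temperedDiff σ Y) (deriv Y t - exp (-σ) * deriv Y (t - 1)) t :=
    (hY t).hasDerivAt.sub (h2.const_mul _)
  simp only [substD, h.deriv, temperedDiff]
  ring

theorem differentiable_iterate_temperedDiff {σ : ℂ} {Y : ℝ → ℂ} (hY : Differentiable ℝ Y) (n : ℕ) :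
    Differentiable ℝ ((temperedDiff σ)^[n] Y) := by
  induction n with
  | zero => exact hY
  | succ n ih =>
    rw [Function.iterate_succ_apply']
    exact differentiable_temperedDiff ih

theorem substD_iterate_temperedDiff {σ : ℂ} {Y : ℝ → ℂ} (hY : Differentiable ℝ Y) (n : ℕ) :
    substD σ ((temperedDiff σ)^[n] Y) = (temperedDiff σ)^[n] (substD σ Y) := by
  induction n with
  | zero => rfl
  | succ n ih =>
    rw [Function.iterate_succ_apply', Function.iterate_succ_apply',
      substD_temperedDiff (differentiable_iterate_temperedDiff hY n), ih]

theorem integrable_diffSymb_pow_mul {σ : ℂ} (hσ : 0 ≤ σ.re) {V : ℝ → ℂ} (hV : Integrable V)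
    (n : ℕ) : Integrable fun ω => diffSymb σ ω ^ n * V ω := by
  induction n with
  | zero => simpa using hV
  | succ n ih =>
    refine (integrable_diffSymb_mul hσ ih).congr (Filter.Eventually.of_forall fun ω => ?_)
    simp only
    ring

/-- Differences commute with d/dt + σ, so the derivatives can be traded for differences one at a
time. Only the top derivative has to be an inverse Fourier integral. -/
theorem iterate_temperedDiff_ae_eq {σ : ℂ} (hσ : 0 ≤ σ.re) {V : ℝ → ℂ} (hV : Integrable V)
    (n : ℕ) : ∀ Y : ℝ → ℂ, (∀ k < n, Differentiable ℝ ((substD σ)^[k] Y)) →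
      (substD σ)^[n] Y =ᵐ[volume] invF V →
      (temperedDiff σ)^[n] Y =ᵐ[volume] invF (fun ω => diffSymb σ ω ^ n * V ω) := by
  induction n with
  | zero => intro Y _ h; simpa using h
  | succ n ih =>
    intro Y hY h
    have h0 : Differentiable ℝ Y := hY 0 (Nat.succ_pos n)
    have h1 := ih (substD σ Y) (fun k hk => hY (k + 1) (Nat.succ_lt_succ hk)) h
    rw [← substD_iterate_temperedDiff h0] at h1
    refine Filter.Eventually.of_forall fun t => ?_
    rw [Function.iterate_succ_apply', temperedDiff_eq_invF
      (differentiable_iterate_temperedDiff h0 n) (integrable_diffSymb_pow_mul hσ hV n) h1]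
    congr 1
    ext ω
    ring

theorem norm_exp_neg_symb_le {σ : ℂ} (hσ : 0 ≤ σ.re) (ω : ℝ) : ‖exp (-symb σ ω)‖ ≤ 1 := by
  rw [norm_exp, Real.exp_le_one_iff, neg_re, symb_re]
  linarith

theorem integrable_one_sub_exp_pow_mul {σ : ℂ} (hσ : 0 ≤ σ.re) {M : ℝ → ℂ} (hM : Integrable M)
    (n : ℕ) : Integrable fun ω => (1 - exp (-symb σ ω)) ^ n * M ω := by
  have := continuous_symb σ
  refine hM.bdd_mul (c := 2 ^ n) (by fun_prop : Continuous _).aestronglyMeasurable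
    (Filter.Eventually.of_forall fun ω => ?_)
  rw [norm_pow]
  gcongr
  refine (norm_sub_le _ _).trans ?_
  have := norm_exp_neg_symb_le hσ ω
  rw [norm_one]
  linarith

theorem iterate_temperedDiff_invF {σ : ℂ} (hσ : 0 ≤ σ.re) {M : ℝ → ℂ} (hM : Integrable M) (n : ℕ) :
    (temperedDiff σ)^[n] (invF M) = invF (fun ω => (1 - exp (-symb σ ω)) ^ n * M ω) := by
  induction n with
  | zero => simp
  | succ n ih =>
    rw [Function.iterate_succ_apply', ih]
    ext t
    have hn := integrable_one_sub_exp_pow_mul hσ hM n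
    rw [temperedDiff, invF, invF, invF, ← integral_const_mul, ← integral_sub
      (integrable_exp_mul hn t) ((integrable_exp_mul hn (t - 1)).const_mul _)]
    congr 1
    ext ω
    have : exp ((2 * Real.pi * ω * (t - 1) : ℝ) * I) * exp (-σ)
        = exp ((2 * Real.pi * ω * t : ℝ) * I) * exp (-symb σ ω) := by
      rw [← Complex.exp_add, ← Complex.exp_add, symb]
      congr 1
      push_cast
      ring
    linear_combination (-(1 - exp (-symb σ ω)) ^ n * M ω) * this

/-- A zero forces e^(-s) = 1, which happens for at most countably many frequencies. -/
theorem ae_diffSymb_ne_zero (σ : ℂ) : ∀ᵐ ω : ℝ, diffSymb σ ω ≠ 0 := by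
  have hc : (Set.range fun n : ℤ => (-n : ℝ) - σ.im / (2 * Real.pi)).Countable :=
    Set.countable_range _
  filter_upwards [hc.ae_notMem volume] with ω hω h0
  have h := symb_mul_diffSymb σ ω
  rw [h0, mul_zero, eq_comm, sub_eq_zero, eq_comm, exp_eq_one_iff] at h
  obtain ⟨n, hn⟩ := h
  have him := congrArg Complex.im hn
  rw [neg_im, symb_im] at him
  simp at him
  refine hω ⟨n, ?_⟩
  have := Real.pi_pos
  field_simp
  linarith

/-- If the `n`-fold application of `d/dt + σ` to an inverse Fourier integral is again one, then
the transforms are related by the `n`-th power of the symbol. -/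
theorem symb_pow_mul_ae_eq {σ : ℂ} (hσ : 0 ≤ σ.re) {M V : ℝ → ℂ} (hM : Integrable M)
    (hV : Integrable V) (n : ℕ) (hd : ∀ k < n, Differentiable ℝ ((substD σ)^[k] (invF M)))
    (h : (substD σ)^[n] (invF M) =ᵐ[volume] invF V) :
    (fun ω => symb σ ω ^ n * M ω) =ᵐ[volume] V := by
  have h1 := iterate_temperedDiff_ae_eq hσ hV n _ hd h
  rw [iterate_temperedDiff_invF hσ hM] at h1
  have i1 := integrable_one_sub_exp_pow_mul hσ hM n
  have i2 := integrable_diffSymb_pow_mul hσ hV n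
  -- Continuity upgrades the identity to every t. Uniqueness then gives (1 - e^(-s))^n M =
  -- `diffSymb`^n V almost everywhere, and `diffSymb`^n cancels.
  rw [Continuous.ae_eq_iff_eq volume (continuous_invF i1) (continuous_invF i2)] at h1
  filter_upwards [ae_eq_of_invF_eq i1 i2 (congrFun h1), ae_diffSymb_ne_zero σ] with ω hω hne
  rw [← symb_mul_diffSymb, mul_pow] at hω
  refine mul_left_cancel₀ (pow_ne_zero n hne) ?_
  linear_combination hω

/-! ### The fractional integral as a multiplier -/

theorem intervalIntegrable_abs_rpow {a : ℝ} (ha : -1 < a) :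
    IntervalIntegrable (fun x : ℝ => |x| ^ a) volume (-1) 1 := by
  have h1 : IntervalIntegrable (fun x : ℝ => |x| ^ a) volume 0 1 := by
    refine (intervalIntegral.intervalIntegrable_rpow' ha).congr fun x hx => ?_
    rw [Set.uIoc_of_le zero_le_one] at hx
    simp only [abs_of_pos hx.1]
  have h2 : IntervalIntegrable (fun x : ℝ => |x| ^ a) volume 0 (-1) := by
    simpa using (IntervalIntegrable.iff_comp_neg (by finiteness)).1 h1
  exact h2.symm.trans h1

/-- Within distance 1 of c, f is bounded and the singularity is integrable; beyond it the weight is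
at most 1. This serves both the kernel in time and the factor s^(γ-1) in frequency. -/
theorem integrable_abs_sub_rpow_mul_norm {f : ℝ → ℂ} (hf : Integrable f) {B : ℝ}
    (hB : ∀ᵐ x, ‖f x‖ ≤ B) {a : ℝ} (ha : -1 < a) (ha0 : a ≤ 0) (c : ℝ) :
    Integrable fun x : ℝ => |x - c| ^ a * ‖f x‖ := by
  have h1 : IntegrableOn (fun x : ℝ => |x - c| ^ a) (Set.Ioc (-1 + c) (1 + c)) :=
    (intervalIntegrable_iff_integrableOn_Ioc_of_le (by linarith)).1
      ((intervalIntegrable_abs_rpow ha).comp_sub_right c)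
  have h2 := (integrable_indicator_iff measurableSet_Ioc).2 (h1.const_mul B)
  refine (h2.add hf.norm).mono' ?_ ?_
  · exact (by fun_prop : Measurable fun x : ℝ => |x - c| ^ a).aestronglyMeasurable.mul hf.1.norm
  · filter_upwards [hB] with x hx
    have hpos : 0 ≤ |x - c| ^ a := by positivity
    rw [Real.norm_of_nonneg (by positivity)]
    by_cases hxc : x ∈ Set.Ioc (-1 + c) (1 + c)
    · simp only [Pi.add_apply, Set.indicator_of_mem hxc]
      nlinarith [norm_nonneg (f x)]
    · simp only [Pi.add_apply, Set.indicator_of_notMem hxc, zero_add]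
      refine mul_le_of_le_one_left (norm_nonneg _) (Real.rpow_le_one_of_one_le_of_nonpos ?_ ha0)
      by_contra hlt
      rw [not_le, abs_lt] at hlt
      exact hxc ⟨by linarith, by linarith⟩

theorem integrableOn_substIntegrand {γ : ℝ} (h0 : 0 < γ) (h1 : γ < 1) {σ : ℂ} (hσ : 0 ≤ σ.re)
    {G : ℝ → ℂ} (hG : Integrable G) {B : ℝ} (hB : ∀ᵐ x, ‖G x‖ ≤ B) (t : ℝ) :
    IntegrableOn (substIntegrand γ σ G t) (Set.Iio t) := by
  have h := integrable_abs_sub_rpow_mul_norm hG hB (a := -γ) (by linarith) (by linarith) t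
  refine h.integrableOn.mono' ?_ ?_
  · exact ((by fun_prop : Measurable fun z : ℝ => (((t - z) ^ (-γ) : ℝ) : ℂ) *
      exp (-σ * ((t - z : ℝ) : ℂ))).aestronglyMeasurable.mul hG.1).restrict
  · filter_upwards [ae_restrict_mem measurableSet_Iio] with z hz
    have hz' : 0 < t - z := sub_pos.2 hz
    rw [substIntegrand, norm_mul, norm_mul, norm_real, Real.norm_of_nonneg (by positivity),
      abs_sub_comm, abs_of_pos hz']
    gcongr
    exact mul_le_of_le_one_right (by positivity) (norm_exp_neg_mul_le hσ hz'.le)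

theorem integral_Iio_substIntegrand (γ : ℝ) (σ : ℂ) (G : ℝ → ℂ) (t : ℝ) :
    ∫ z in Set.Iio t, substIntegrand γ σ G t z
      = ∫ y : ℝ in Set.Ioi 0, ((y ^ (-γ) : ℝ) : ℂ) * exp (-σ * y) * G (t - y) := by
  rw [← integral_indicator measurableSet_Iio, ← integral_indicator measurableSet_Ioi,
    ← integral_sub_left_eq_self _ volume t]
  congr 1
  ext y
  by_cases hy : 0 < y
  · rw [Set.indicator_of_mem (by simpa using hy), Set.indicator_of_mem (by simpa using hy),
      substIntegrand, sub_sub_cancel]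
  · rw [Set.indicator_of_notMem (by simpa using hy), Set.indicator_of_notMem (by simpa using hy)]

theorem ae_symb_im_ne_zero (σ : ℂ) : ∀ᵐ ω : ℝ, (symb σ ω).im ≠ 0 := by
  filter_upwards [(Set.countable_singleton (-σ.im / (2 * Real.pi))).ae_notMem volume] with ω hω h
  rw [symb_im] at h
  refine hω ?_
  have := Real.pi_pos
  rw [Set.mem_singleton_iff]
  field_simp
  linarith

theorem integrable_abs_symb_im_rpow_mul {V : ℝ → ℂ} (hV : Integrable V) {B : ℝ}
    (hB : ∀ᵐ x, ‖V x‖ ≤ B) {a : ℝ} (ha : -1 < a) (ha0 : a ≤ 0) (σ : ℂ) :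
    Integrable fun ω : ℝ => |(symb σ ω).im| ^ a * ‖V ω‖ := by
  have h := (integrable_abs_sub_rpow_mul_norm hV hB ha ha0 (-σ.im / (2 * Real.pi))).const_mul
    ((2 * Real.pi) ^ a)
  refine h.congr (Filter.Eventually.of_forall fun ω => ?_)
  have hpi := Real.pi_pos
  simp only
  rw [← mul_assoc, ← Real.mul_rpow (by positivity) (abs_nonneg _), symb_im,
    ← abs_of_pos (by positivity : (0 : ℝ) < 2 * Real.pi), ← abs_mul,
    abs_of_pos (by positivity : (0 : ℝ) < 2 * Real.pi)]
  congr 3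
  field_simp
  ring

/-- Only the imaginary part enters the bound, so it is uniform under real shifts of z, as the limit
ε → 0 in `substIntegral_eq_invF` requires. -/
theorem norm_cpow_le_abs_im_rpow {z : ℂ} (hz : z.im ≠ 0) {a : ℝ} (ha : a ≤ 0) :
    ‖z ^ (a : ℂ)‖ ≤ |z.im| ^ a := by
  rw [Complex.norm_cpow_real]
  exact Real.rpow_le_rpow_of_nonpos (abs_pos.2 hz) (Complex.abs_im_le_norm z) ha

theorem integrable_symb_cpow_mul {V : ℝ → ℂ} (hV : Integrable V) {B : ℝ}
    (hB : ∀ᵐ x, ‖V x‖ ≤ B) {a : ℝ} (ha : -1 < a) (ha0 : a ≤ 0) (σ : ℂ) :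
    Integrable fun ω : ℝ => symb σ ω ^ (a : ℂ) * V ω := by
  refine (integrable_abs_symb_im_rpow_mul hV hB ha ha0 σ).mono' ?_ ?_
  · have := (continuous_symb σ).measurable
    exact (by fun_prop : Measurable fun ω => symb σ ω ^ (a : ℂ)).aestronglyMeasurable.mul hV.1
  · filter_upwards [ae_symb_im_ne_zero σ] with ω hω
    rw [norm_mul]
    gcongr
    exact norm_cpow_le_abs_im_rpow hω ha0

/-- The substantial fractional integral acts on Fourier transforms as multiplication by
`symb σ ^ (γ - 1)`. This includes the case `σ = 0`. -/
theorem substIntegral_eq_invF {γ : ℝ} (h0 : 0 < γ) (h1 : γ < 1) {σ : ℂ} (hσ : 0 ≤ σ.re)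
    {G V : ℝ → ℂ} (hG : Integrable G) (hV : Integrable V) {B : ℝ} (hB : ∀ᵐ x, ‖V x‖ ≤ B)
    (hGV : G =ᵐ[volume] invF V) (t : ℝ) :
    substIntegral γ σ G t = invF (fun ω => symb σ ω ^ ((γ - 1 : ℝ) : ℂ) * V ω) t := by
  have hg : Integrable (invF V) := hG.congr hGV
  -- When Re σ = 0 the kernel is not integrable at infinity. The damping e^(-εy) makes Fubini
  -- available, and dominated convergence removes it on both sides.
  set ε : ℕ → ℝ := fun n => 1 / ((n : ℝ) + 1)
  have hε0 (n : ℕ) : 0 < ε n := by positivity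
  have hε : Filter.Tendsto ε Filter.atTop (nhds 0) := tendsto_one_div_add_atTop_nhds_zero_nat
  have hεc : Filter.Tendsto (fun n => (ε n : ℂ)) Filter.atTop (nhds 0) := by
    simpa using! (continuous_ofReal.tendsto 0).comp hε
  set Γ : ℝ := Real.Gamma (1 - γ) with hΓ
  have hΓ0 : Γ ≠ 0 := (Real.Gamma_pos_of_pos (by linarith)).ne'
  have hA (n : ℕ) :
      ∫ y : ℝ in Set.Ioi 0, (((y ^ (-γ) : ℝ) : ℂ) * exp (-(σ + ε n) * y)) * invF V (t - y)
      = invF (fun ω => Γ * (symb σ ω + ε n) ^ ((γ - 1 : ℝ) : ℂ) * V ω) t := by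
    rw [integral_mul_invF_sub _ hV t]
    · congr 1
      ext ω
      congr 1
      have hL := integral_rpow_neg_mul_cexp h1 (s := symb σ ω + ε n)
        (by rw [add_re, symb_re, ofReal_re]; linarith [hε0 n])
      rw [show ((γ - 1 : ℝ) : ℂ) = (γ : ℂ) - 1 by push_cast; rfl, ← hL]
      congr 1
      ext y
      rw [mul_assoc, ← Complex.exp_add, symb]
      ring_nf
    · refine (integrableOn_rpow_mul_exp_neg_mul (a := -γ) (by linarith) (hε0 n)).mono'
        (by fun_prop : Measurable _).aestronglyMeasurable ?_
      filter_upwards [ae_restrict_mem measurableSet_Ioi] with x hx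
      have hx0 : (0 : ℝ) < x := hx
      rw [norm_mul, norm_real, norm_exp, Real.norm_of_nonneg (by positivity)]
      gcongr
      simp
      nlinarith
  have hlim1 : Filter.Tendsto (fun n => ∫ y : ℝ in Set.Ioi 0,
      (((y ^ (-γ) : ℝ) : ℂ) * exp (-(σ + ε n) * y)) * invF V (t - y)) Filter.atTop
      (nhds (∫ y : ℝ in Set.Ioi 0, (((y ^ (-γ) : ℝ) : ℂ) * exp (-σ * y)) * invF V (t - y))) := by
    have hb := integrable_abs_sub_rpow_mul_norm (hg.comp_sub_left t) (B := ∫ ω, ‖V ω‖)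
      (Filter.Eventually.of_forall fun x => norm_invF_le V (t - x)) (a := -γ) (by linarith)
      (by linarith) 0
    have hgm := (hg.comp_sub_left t).1
    refine tendsto_integral_of_dominated_convergence _ (fun n => ?_) (hb.integrableOn (s := Set.Ioi 0))
      (fun n => ?_) ?_
    · exact ((by fun_prop : Measurable fun y : ℝ => ((y ^ (-γ) : ℝ) : ℂ) *
        exp (-(σ + ε n) * y)).aestronglyMeasurable.mul hgm).restrict
    · filter_upwards [ae_restrict_mem measurableSet_Ioi] with y hy
      have hy0 : (0 : ℝ) < y := hy
      rw [norm_mul, norm_mul, norm_real, Real.norm_of_nonneg (by positivity), sub_zero,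
        abs_of_pos hy0]
      gcongr
      refine mul_le_of_le_one_right (by positivity) (norm_exp_neg_mul_le ?_ hy0.le)
      rw [add_re, ofReal_re]
      linarith [hε0 n]
    · refine Filter.Eventually.of_forall fun y => ?_
      have hc : Continuous fun e : ℂ => (((y ^ (-γ) : ℝ) : ℂ) * exp (-(σ + e) * y)) *
          invF V (t - y) := by fun_prop
      simpa using! (hc.tendsto 0).comp hεc
  have hlim2 : Filter.Tendsto (fun n =>
      invF (fun ω => Γ * (symb σ ω + ε n) ^ ((γ - 1 : ℝ) : ℂ) * V ω) t) Filter.atTop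
      (nhds (invF (fun ω => Γ * symb σ ω ^ ((γ - 1 : ℝ) : ℂ) * V ω) t)) := by
    have hb := (integrable_abs_symb_im_rpow_mul hV hB (a := γ - 1) (by linarith) (by linarith)
      σ).const_mul |Γ|
    refine tendsto_integral_of_dominated_convergence _ (fun n => ?_) hb (fun n => ?_) ?_
    · have := (continuous_symb σ).measurable
      exact (by fun_prop : Measurable fun ω : ℝ => exp ((2 * Real.pi * ω * t : ℝ) * I)
        ).aestronglyMeasurable.mul ((by fun_prop : Measurable fun ω : ℝ =>
          Γ * (symb σ ω + ε n) ^ ((γ - 1 : ℝ) : ℂ)).aestronglyMeasurable.mul hV.1)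
    · filter_upwards [ae_symb_im_ne_zero σ] with ω hω
      have him : (symb σ ω + ε n).im = (symb σ ω).im := by simp
      rw [norm_mul, norm_exp_ofReal_mul_I, one_mul, norm_mul, norm_mul, norm_real, mul_assoc,
        Real.norm_eq_abs]
      gcongr
      exact him ▸ norm_cpow_le_abs_im_rpow (him ▸ hω) (by linarith)
    · filter_upwards [ae_symb_im_ne_zero σ] with ω hω
      have hc : ContinuousAt (fun e : ℂ => exp ((2 * Real.pi * ω * t : ℝ) * I) *
          (Γ * (symb σ ω + e) ^ ((γ - 1 : ℝ) : ℂ) * V ω)) 0 := by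
        have : symb σ ω + 0 ∈ slitPlane := by
          rw [add_zero, mem_slitPlane_iff]
          exact Or.inr hω
        have h2 : ContinuousAt (fun e : ℂ => (symb σ ω + e) ^ ((γ - 1 : ℝ) : ℂ)) 0 :=
          ContinuousAt.cpow (by fun_prop) continuousAt_const this
        fun_prop
      simpa using! hc.tendsto.comp hεc
  simp_rw [hA] at hlim1
  have heq := tendsto_nhds_unique hlim1 hlim2
  have hGg : ∫ y : ℝ in Set.Ioi 0, (((y ^ (-γ) : ℝ) : ℂ) * exp (-σ * y)) * G (t - y)
      = ∫ y : ℝ in Set.Ioi 0, (((y ^ (-γ) : ℝ) : ℂ) * exp (-σ * y)) * invF V (t - y) := by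
    refine integral_congr_ae (ae_restrict_of_ae ?_)
    filter_upwards [(quasiMeasurePreserving_sub_left volume t).ae_eq hGV] with y hy
    simp only [Function.comp] at hy
    rw [hy]
  rw [substIntegral, integral_Iio_substIntegrand, hGg, heq, invF, invF, ← integral_const_mul]
  congr 1
  ext ω
  have : (Γ : ℂ) ≠ 0 := by exact_mod_cast hΓ0
  rw [← hΓ]
  push_cast
  field_simp

/-! ### The error estimate -/

theorem invF_add_const_mul {f g : ℝ → ℂ} (hf : Integrable f) (hg : Integrable g) (c : ℂ) (t : ℝ) :
    invF (fun x => f x + c * g x) t = invF f t + c * invF g t := by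
  rw [invF, invF, invF, ← integral_const_mul]
  refine Eq.trans ?_ (integral_add (integrable_exp_mul hf t) ((integrable_exp_mul hg t).const_mul c))
  congr 1
  ext ω
  ring

theorem fourier_add_const_mul {f g : ℝ → ℂ} (hf : Integrable f) (hg : Integrable g) (c : ℂ) :
    𝓕 (fun x => f x + c * g x) = fun ω => 𝓕 f ω + c * 𝓕 g ω := by
  ext ω
  have h (H : ℝ → ℂ) : 𝓕 H ω = invF H (-ω) := by rw [invF_eq_fourier_neg, neg_neg]
  rw [h, h, h, invF_add_const_mul hf hg]

/-- The scaled symbol estimate. -/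
theorem exists_norm_cpow_sub_scaled_le {ν : ℕ} (hν : 1 ≤ ν) {γ : ℝ} (h0 : 0 < γ) (h1 : γ ≤ 1) :
    ∃ C : ℝ, 0 ≤ C ∧ ∀ s : ℂ, 0 ≤ s.re → ∀ τ : ℝ, 0 < τ →
      ‖s ^ (γ : ℂ) - ((1 / τ ^ γ : ℝ) : ℂ) * logPoly ν (1 - exp (-s * τ)) ^ (γ : ℂ)‖
        ≤ C * ‖s‖ ^ (γ + ν) * τ ^ ν := by
  obtain ⟨C, hC0, hC⟩ := exists_norm_logPoly_cpow_sub_cpow_le hν h0 h1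
  refine ⟨C, hC0, fun s hs τ hτ => ?_⟩
  have hz : 0 ≤ (s * τ).re := by simpa using mul_nonneg hs hτ.le
  have h := hC (s * τ) hz
  have hpos : 0 < τ ^ γ := Real.rpow_pos_of_pos hτ _
  rw [Complex.mul_cpow_of_re_nonneg_of_re_pos hs (by simpa using hτ), ← ofReal_cpow hτ.le,
    norm_mul, norm_real, Real.norm_of_nonneg hτ.le, Real.mul_rpow (norm_nonneg _) hτ.le,
    Real.rpow_add hτ, Real.rpow_natCast, ← neg_mul] at h
  have hne : ((τ ^ γ : ℝ) : ℂ) ≠ 0 := by exact_mod_cast hpos.ne'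
  have e : s ^ (γ : ℂ) - ((1 / τ ^ γ : ℝ) : ℂ) * logPoly ν (1 - exp (-s * τ)) ^ (γ : ℂ)
      = -(((1 / τ ^ γ : ℝ) : ℂ) * (logPoly ν (1 - exp (-s * τ)) ^ (γ : ℂ)
        - s ^ (γ : ℂ) * ((τ ^ γ : ℝ) : ℂ))) := by
    rw [ofReal_div, ofReal_one]
    field_simp
    ring
  rw [e, norm_neg, norm_mul, norm_real, Real.norm_of_nonneg (by positivity)]
  calc 1 / τ ^ γ * _ ≤ 1 / τ ^ γ * (C * (‖s‖ ^ (γ + ν) * (τ ^ γ * τ ^ ν))) := by gcongr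
    _ = _ := by field_simp

/-- The discretised operator acts on Fourier transforms as multiplication by its generating
function. -/
theorem hasSum_genCoeff_mul_invF {ν : ℕ} (hν1 : 1 ≤ ν) (hν4 : ν ≤ 4) {γ : ℝ} (h0 : 0 < γ)
    (h1 : γ < 1) {σ : ℂ} (hσ : 0 ≤ σ.re) {V : ℝ → ℂ} (hV : Integrable V) {τ : ℝ} (hτ : 0 < τ)
    (t : ℝ) :
    Integrable (fun ω => logPoly ν (1 - exp (-symb σ ω * τ)) ^ (γ : ℂ) * V ω) ∧
    HasSum (fun m : ℕ => genCoeff ν γ σ τ m * invF V (t - m * τ))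
      (invF (fun ω => logPoly ν (1 - exp (-symb σ ω * τ)) ^ (γ : ℂ) * V ω) t) := by
  obtain ⟨a, ha, ha'⟩ := exists_hasSum_logPoly_cpow hν1 hν4 h0 h1
  have he (ω : ℝ) : ‖exp (-symb σ ω * τ)‖ ≤ 1 :=
    norm_exp_neg_mul_le (by rw [symb_re]; exact hσ) hτ.le
  have hcs := continuous_symb σ
  have hle (m : ℕ) (ω : ℝ) : ‖a m * exp (-symb σ ω * τ) ^ m‖ ≤ ‖a m‖ := by
    rw [norm_mul, norm_pow]
    exact mul_le_of_le_one_right (norm_nonneg _) (pow_le_one₀ (norm_nonneg _) (he ω))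
  constructor
  · refine hV.bdd_mul (c := ∑' m, ‖a m‖) ?_ (Filter.Eventually.of_forall fun ω => ?_)
    · have : Continuous (logPoly ν) := by unfold logPoly; fun_prop
      have := this.measurable
      have := hcs.measurable
      exact (by fun_prop : Measurable fun ω : ℝ =>
        logPoly ν (1 - exp (-symb σ ω * τ)) ^ (γ : ℂ)).aestronglyMeasurable
    · rw [← (ha' _ (he ω)).tsum_eq]
      exact tsum_of_norm_bounded ha.hasSum fun m => hle m ω
  set F : ℕ → ℝ → ℂ := fun m ω =>
    exp ((2 * Real.pi * ω * t : ℝ) * I) * ((a m * exp (-symb σ ω * τ) ^ m) * V ω) with hF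
  have hFi (m : ℕ) : Integrable (F m) :=
    integrable_exp_mul (hV.bdd_mul (by fun_prop : Continuous _).aestronglyMeasurable
      (Filter.Eventually.of_forall (hle m))) t
  have hFn (m : ℕ) : ∫ ω, ‖F m ω‖ ≤ ‖a m‖ * ∫ ω, ‖V ω‖ := by
    rw [← integral_const_mul]
    refine integral_mono (hFi m).norm (hV.norm.const_mul _) fun ω => ?_
    simp only [hF]
    rw [norm_mul, norm_exp_ofReal_mul_I, one_mul, norm_mul]
    gcongr
    exact hle m ω
  -- Termwise integration is justified by the summable majorant ‖a m‖ ∫ ‖V‖.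
  have hs := hasSum_integral_of_summable_integral_norm hFi (Summable.of_nonneg_of_le
    (fun m => integral_nonneg fun ω => norm_nonneg _) hFn (ha.mul_right _))
  convert! hs using 1
  · ext m
    rw [genCoeff_eq ha' hσ hτ, invF, ← integral_const_mul]
    congr 1
    ext ω
    have : exp ((2 * Real.pi * ω * (t - m * τ) : ℝ) * I) * exp (-σ * τ) ^ m
        = exp ((2 * Real.pi * ω * t : ℝ) * I) * exp (-symb σ ω * τ) ^ m := by
      rw [← Complex.exp_nat_mul, ← Complex.exp_nat_mul, ← Complex.exp_add, ← Complex.exp_add, symb]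
      congr 1
      push_cast
      ring
    simp only [hF]
    linear_combination (a m * V ω) * this
  · rw [invF]
    congr 1
    ext ω
    rw [((((ha' _ (he ω)).mul_right (V ω)).mul_left
      (exp ((2 * Real.pi * ω * t : ℝ) * I)))).tsum_eq]

/-- The scaled symbol estimate is used twice: under the integral at s = `symb σ ω`, and at the
single point s = λ for the multiple of `invF V`, whose size is at most ∫ ‖V‖. -/
theorem norm_invF_sub_approxOp_le {ν : ℕ} (hν1 : 1 ≤ ν) (hν4 : ν ≤ 4) {γ : ℝ} (h0 : 0 < γ)
    (h1 : γ < 1) {lam : ℝ} (hlam : 0 ≤ lam) {σ : ℂ} (hσ : 0 ≤ σ.re) {V : ℝ → ℂ}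
    (hV : Integrable V) (hγV : Integrable fun ω => symb σ ω ^ (γ : ℂ) * V ω)
    (hN : Integrable fun ω => ‖symb σ ω‖ ^ (γ + ν) * ‖V ω‖) :
    ∃ C : ℝ, ∀ τ : ℝ, 0 < τ → ∀ t : ℝ,
      ‖invF (fun ω => symb σ ω ^ (γ : ℂ) * V ω) t - ((lam ^ γ : ℝ) : ℂ) * invF V t
        - approxOp ν γ lam σ τ (invF V) t‖ ≤ C * τ ^ ν := by
  obtain ⟨C, hC0, hC⟩ := exists_norm_cpow_sub_scaled_le hν1 h0 h1.le
  refine ⟨C * (∫ ω, ‖symb σ ω‖ ^ (γ + ν) * ‖V ω‖) + C * ‖(lam : ℂ)‖ ^ (γ + ν) * ∫ ω, ‖V ω‖,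
    fun τ hτ t => ?_⟩
  obtain ⟨hPi, hsum⟩ := hasSum_genCoeff_mul_invF hν1 hν4 h0 h1 hσ hV hτ t
  set c : ℂ := ((1 / τ ^ γ : ℝ) : ℂ) with hc
  have hw : 0 ≤ 1 - Real.exp (-lam * τ) := by
    rw [sub_nonneg, Real.exp_le_one_iff]
    nlinarith
  have hR : (((∑ l ∈ Finset.Icc 1 ν, (1 / (l : ℝ)) * (1 - Real.exp (-lam * τ)) ^ l) ^ γ : ℝ) : ℂ)
      = logPoly ν (1 - exp (-(lam : ℂ) * τ)) ^ (γ : ℂ) := by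
    rw [ofReal_cpow (Finset.sum_nonneg fun l _ => by positivity), logPoly]
    push_cast
    rfl
  have hlamc : ((lam ^ γ : ℝ) : ℂ) = (lam : ℂ) ^ (γ : ℂ) := ofReal_cpow hlam γ
  rw [approxOp, hsum.tsum_eq, hR, hlamc]
  have e1 : invF (fun ω => (symb σ ω ^ (γ : ℂ)
      - c * logPoly ν (1 - exp (-symb σ ω * τ)) ^ (γ : ℂ)) * V ω) t
      = invF (fun ω => symb σ ω ^ (γ : ℂ) * V ω) t
        - c * invF (fun ω => logPoly ν (1 - exp (-symb σ ω * τ)) ^ (γ : ℂ) * V ω) t := by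
    have := invF_add_const_mul hγV hPi (-c) t
    rw [neg_mul, ← sub_eq_add_neg] at this
    rw [← this]
    congr 1
    ext ω
    ring
  have e2 : invF (fun ω => symb σ ω ^ (γ : ℂ) * V ω) t - (lam : ℂ) ^ (γ : ℂ) * invF V t
      - (c * invF (fun ω => logPoly ν (1 - exp (-symb σ ω * τ)) ^ (γ : ℂ) * V ω) t
        - c * logPoly ν (1 - exp (-(lam : ℂ) * τ)) ^ (γ : ℂ) * invF V t)
      = invF (fun ω => (symb σ ω ^ (γ : ℂ)
          - c * logPoly ν (1 - exp (-symb σ ω * τ)) ^ (γ : ℂ)) * V ω) t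
        - ((lam : ℂ) ^ (γ : ℂ) - c * logPoly ν (1 - exp (-(lam : ℂ) * τ)) ^ (γ : ℂ))
          * invF V t := by
    rw [e1]
    ring
  rw [e2]
  refine (norm_sub_le _ _).trans ?_
  rw [add_mul]
  refine add_le_add ?_ ?_
  · refine (norm_invF_le _ t).trans ?_
    rw [mul_assoc, mul_comm _ (τ ^ ν), ← integral_const_mul, ← integral_const_mul]
    refine integral_mono_of_nonneg (Filter.Eventually.of_forall fun ω => norm_nonneg _)
      ((hN.const_mul _).const_mul _) (Filter.Eventually.of_forall fun ω => ?_)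
    have := hC (symb σ ω) (by rw [symb_re]; exact hσ) τ hτ
    simp only
    rw [norm_mul]
    calc _ ≤ C * ‖symb σ ω‖ ^ (γ + ν) * τ ^ ν * ‖V ω‖ := by gcongr
      _ = _ := by ring
  · rw [norm_mul]
    have := hC lam (by simpa using hlam) τ hτ
    calc _ ≤ (C * ‖(lam : ℂ)‖ ^ (γ + ν) * τ ^ ν) * ∫ ω, ‖V ω‖ := by
          gcongr
          exact norm_invF_le V t
      _ = _ := by ring

theorem temperedParam_re_nonneg {lam ρ η u : ℝ} (hlam : 0 ≤ lam) (hρ : 0 < ρ) (hu : 0 ≤ u) :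
    0 ≤ (temperedParam lam ρ η u).re := by
  have : (temperedParam lam ρ η u).re = lam + ρ * u := by simp [temperedParam]
  rw [this]
  positivity

/-- Existence of the substantial derivative of order `γ + ν` as an integrable function with
integrable transform makes `|symb| ^ (γ + ν) * |𝓕 G|` integrable. -/
theorem integrable_symb_pow_mul {γ : ℝ} {ν : ℕ} {lam : ℝ} {σ : ℂ} (hσ : 0 ≤ σ.re) {G M : ℝ → ℂ}
    (hG : Integrable G) (hGhat : Integrable (𝓕 G)) (hM : Integrable M)
    (hI : substIntegral γ σ G = invF M) (hex : HasSubstFracDeriv γ ν σ G)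
    (hD : Integrable (temperedSubstDeriv γ ν lam σ G))
    (hDhat : Integrable (𝓕 (temperedSubstDeriv γ ν lam σ G))) :
    Integrable fun ω => symb σ ω ^ (ν + 1) * M ω := by
  set W := substFracDeriv γ ν σ G with hW
  have hWe : W = fun t => temperedSubstDeriv γ ν lam σ G t + ((lam ^ (γ + ν) : ℝ) : ℂ) * G t := by
    ext t
    simp [temperedSubstDeriv, hW]
  have hWi : Integrable W := by
    rw [hWe]
    exact hD.add (hG.const_mul _)
  have hWh : Integrable (𝓕 W) := by
    rw [hWe, fourier_add_const_mul hD hG]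
    exact hDhat.add (hGhat.const_mul _)
  rw [HasSubstFracDeriv, hI] at hex
  rw [substFracDeriv, hI] at hW
  exact hWh.congr (symb_pow_mul_ae_eq hσ hM hWh (ν + 1)
    (fun k hk => hex k (Nat.lt_succ_iff.1 hk)) (hW ▸ ae_eq_invF_fourier hWi hWh)).symm

/-- Pointwise values of G are replaced by those of its continuous representative `invF (𝓕 G)`, which
is why the bound holds at every t. -/
theorem exists_norm_substFracDeriv_sub_approxOp_le (ν : ℕ) (hν1 : 1 ≤ ν) (hν4 : ν ≤ 4)
    (γ : ℝ) (hγ0 : 0 < γ) (hγ1 : γ < 1) (lam : ℝ) (hlam : 0 ≤ lam) {σ : ℂ} (hσ : 0 ≤ σ.re)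
    (G : ℝ → ℂ) (hG : Integrable G) (hGhat : Integrable (𝓕 G)) (hex : HasSubstFracDeriv γ ν σ G)
    (hD : Integrable (temperedSubstDeriv γ ν lam σ G))
    (hDhat : Integrable (𝓕 (temperedSubstDeriv γ ν lam σ G))) :
    ∃ C : ℝ, ∀ τ : ℝ, 0 < τ → ∀ t : ℝ,
      Summable (fun m : ℕ => genCoeff ν γ σ τ m * invF (𝓕 G) (t - m * τ)) ∧
      ‖substD σ (substIntegral γ σ G) t - ((lam ^ γ : ℝ) : ℂ) * invF (𝓕 G) t
        - approxOp ν γ lam σ τ (invF (𝓕 G)) t‖ ≤ C * τ ^ ν := by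
  have hGg := ae_eq_invF_fourier hG hGhat
  have hB : ∀ᵐ ω, ‖𝓕 G ω‖ ≤ ∫ x, ‖G x‖ := Filter.Eventually.of_forall fun ω => by
    have := norm_invF_le G (-ω)
    rwa [invF_eq_fourier_neg, neg_neg] at this
  have hM := integrable_symb_cpow_mul hGhat hB (a := γ - 1) (by linarith) (by linarith) σ
  have hI : substIntegral γ σ G = invF (fun ω => symb σ ω ^ ((γ - 1 : ℝ) : ℂ) * 𝓕 G ω) :=
    funext (substIntegral_eq_invF hγ0 hγ1 hσ hG hGhat hB hGg)
  have hpow := integrable_symb_pow_mul hσ hG hGhat hM hI hex hD hDhat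
  have hcpow (z : ℂ) : z * z ^ ((γ - 1 : ℝ) : ℂ) = z ^ (γ : ℂ) := by
    rcases eq_or_ne z 0 with rfl | hz
    · have : (γ : ℂ) ≠ 0 := by exact_mod_cast hγ0.ne'
      simp [this]
    · nth_rewrite 1 [← cpow_one z]
      rw [← cpow_add _ _ hz]
      push_cast
      ring_nf
  have hN : Integrable fun ω => ‖symb σ ω‖ ^ (γ + ν) * ‖𝓕 G ω‖ := by
    refine hpow.norm.congr (Filter.Eventually.of_forall fun ω => ?_)
    simp only
    rw [pow_succ, mul_assoc, ← mul_assoc (symb σ ω), hcpow, norm_mul, norm_mul, norm_pow,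
      Complex.norm_cpow_real, ← mul_assoc, ← Real.rpow_natCast, add_comm γ,
      Real.rpow_add_of_nonneg (norm_nonneg _) (by positivity) hγ0.le]
  -- Interpolation between the two known integrable functions: |s| ≤ 1 + |s|^(ν+1).
  have hsM : Integrable fun ω => symb σ ω * (symb σ ω ^ ((γ - 1 : ℝ) : ℂ) * 𝓕 G ω) := by
    refine (hM.norm.add hpow.norm).mono' ((continuous_symb σ).aestronglyMeasurable.mul hM.1)
      (Filter.Eventually.of_forall fun ω => ?_)
    simp only [Pi.add_apply]
    rw [norm_mul, norm_mul (symb σ ω ^ (ν + 1)), norm_pow, ← one_add_mul]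
    gcongr
    rcases le_total ‖symb σ ω‖ 1 with h | h
    · linarith [pow_nonneg (norm_nonneg (symb σ ω)) (ν + 1)]
    · linarith [le_self_pow₀ h (show ν + 1 ≠ 0 by omega)]
  have hsM' : (fun ω => symb σ ω * (symb σ ω ^ ((γ - 1 : ℝ) : ℂ) * 𝓕 G ω))
      = fun ω => symb σ ω ^ (γ : ℂ) * 𝓕 G ω := by
    ext ω
    rw [← mul_assoc, hcpow]
  obtain ⟨C, hC⟩ := norm_invF_sub_approxOp_le hν1 hν4 hγ0 hγ1 hlam hσ hGhat (hsM' ▸ hsM) hN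
  refine ⟨C, fun τ hτ t => ⟨?_, ?_⟩⟩
  · exact (hasSum_genCoeff_mul_invF hν1 hν4 hγ0 hγ1 hσ hGhat hτ t).2.summable
  · rw [hI, substD_invF hM hsM, hsM']
    exact hC τ hτ t

theorem temperedSubstDeriv_zero (γ lam : ℝ) (σ : ℂ) (G : ℝ → ℂ) (t : ℝ) :
    temperedSubstDeriv γ 0 lam σ G t
      = substD σ (substIntegral γ σ G) t - ((lam ^ γ : ℝ) : ℂ) * G t := by
  simp [temperedSubstDeriv, substFracDeriv]

end

theorem lemma2p4 (ν : ℕ) (hν1 : 1 ≤ ν) (hν4 : ν ≤ 4)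
    (γ : ℝ) (hγ0 : 0 < γ) (hγ1 : γ < 1)
    (lam ρ η u : ℝ) (hlam : 0 ≤ lam) (hρ : 0 < ρ) (hu : 0 ≤ u)
    (G : ℝ → ℂ)
    (hG : MeasureTheory.Integrable G)
    (hGhat : MeasureTheory.Integrable (𝓕 G))
    (hex : HasSubstFracDeriv γ ν (temperedParam lam ρ η u) G)
    (hD : MeasureTheory.Integrable (temperedSubstDeriv γ ν lam (temperedParam lam ρ η u) G))
    (hDhat : MeasureTheory.Integrable
      (𝓕 (temperedSubstDeriv γ ν lam (temperedParam lam ρ η u) G))) :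
    -- the integral that defines the derivative of order `γ` converges at every point
    (∀ t : ℝ, MeasureTheory.IntegrableOn
        (substIntegrand γ (temperedParam lam ρ η u) G t) (Set.Iio t)) ∧
    -- error of order `ν`, with a constant that depends neither on `τ` nor on `t`
    ∃ C : ℝ,
      (∀ τ : ℝ, 0 < τ → ∀ᵐ t : ℝ,
        Summable (fun m : ℕ => genCoeff ν γ (temperedParam lam ρ η u) τ m * G (t - m * τ)) ∧
        ‖temperedSubstDeriv γ 0 lam (temperedParam lam ρ η u) G t
            - approxOp ν γ lam (temperedParam lam ρ η u) τ G t‖ ≤ C * τ ^ ν) ∧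
      (Continuous G → ∀ τ : ℝ, 0 < τ → ∀ t : ℝ,
        Summable (fun m : ℕ => genCoeff ν γ (temperedParam lam ρ η u) τ m * G (t - m * τ)) ∧
        ‖temperedSubstDeriv γ 0 lam (temperedParam lam ρ η u) G t
            - approxOp ν γ lam (temperedParam lam ρ η u) τ G t‖ ≤ C * τ ^ ν) := by
  have hσ := temperedParam_re_nonneg (η := η) hlam hρ hu
  have hGg := ae_eq_invF_fourier hG hGhat
  obtain ⟨C, hC⟩ :=
    exists_norm_substFracDeriv_sub_approxOp_le ν hν1 hν4 γ hγ0 hγ1 lam hlam hσ G hG hGhat hex hD hDhat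
  refine ⟨fun t => integrableOn_substIntegrand hγ0 hγ1 hσ hG (B := ∫ ω, ‖𝓕 G ω‖) ?_ t,
    C, fun τ hτ => ?_, fun hGc τ hτ t => ?_⟩
  · filter_upwards [hGg] with x hx
    rw [hx]
    exact norm_invF_le _ _
  -- The series samples G at countably many translates, so the exceptional set is still null; it may
  -- depend on τ, but C does not.
  · have hshift : ∀ᵐ t : ℝ, ∀ m : ℕ, G (t - m * τ) = invF (𝓕 G) (t - m * τ) :=
      MeasureTheory.ae_all_iff.2 fun m =>
        (MeasureTheory.measurePreserving_sub_right MeasureTheory.volume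
          (m * τ)).quasiMeasurePreserving.ae hGg
    filter_upwards [hGg, hshift] with t ht htm
    have := hC τ hτ t
    rw [temperedSubstDeriv_zero]
    simp only [approxOp, htm, ht] at this ⊢
    exact this
  · have hGe : G = invF (𝓕 G) :=
      (Continuous.ae_eq_iff_eq MeasureTheory.volume hGc (continuous_invF hGhat)).1 hGg
    have := hC τ hτ t
    rw [temperedSubstDeriv_zero]
    rw [← hGe] at this
    exact this
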